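/- **Conventions.** A concrete $\Sigma^*$-algebra is a nondegenerate $C^*$-algebra $\mathfrak B\subseteq B(\mathcal H)$ that contains the limit of every sequence in $\mathfrak B$ that converges in the weak operator topology (WOT) of $B(\mathcal H)$. A *$\Sigma^*$-algebra* is a $C^*$-algebra $\mathfrak B$ with a collection of pairs $((b_n),b)$ (written $b_n\xrightarrow{\sigma}b$) for which there is a faithful representation $\pi:\mathfrak B\to B(\mathcal H)$ such that $\pi(\mathfrak B)$ is a concrete $\Sigma^*$-algebra and $b_n\xrightarrow{\sigma}b$ if and only if $\pi(b_n)\to\pi(b)$ in the WOT. A map is $\sigma$-continuous if it preserves $\sigma$-convergence of sequences; a *$\Sigma^*$-isomorphism* is a $*$-isomorphism that is $\sigma$-continuous with $\sigma$-continuous inverse. For $S\subseteq\mathfrak B$, $\mathscr B(S)$ denotes the smallest subset of $\mathfrak B$ that contains $S$ and is closed under limits of $\sigma$-convergent sequences. A right (resp. left) $C^*$-module $\mathfrak X$ over $\mathfrak B$ is a *$\Sigma^*$-module* if, whenever $(x_n)$ is a sequence in $\mathfrak X$ such that $(\langle x_n|y\rangle)$ is $\sigma$-convergent for every $y\in\mathfrak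 X$, there is $x\in\mathfrak X$ with $\langle x_n|y\rangle\xrightarrow{\sigma}\langle x|y\rangle$ for every $y\in\mathfrak X$. It is *$\sigma$-full* if $\mathscr B(\operatorname{span}\{\langle x|y\rangle: x,y\in\mathfrak X\})=\mathfrak B$. For $\Sigma^*$-algebras $\mathfrak A,\mathfrak B$, an $\mathfrak A$-$\mathfrak B$ bimodule $\mathfrak X$ is an *$\mathfrak A$-$\mathfrak B$ $\Sigma^*$-imprimitivity bimodule* if (1) it is a $\sigma$-full left $\Sigma^*$-module over $\mathfrak A$ and a $\sigma$-full right $\Sigma^*$-module over $\mathfrak B$; (2) ${}_{\mathfrak A}\langle x|y\rangle z=x\langle y|z\rangle_{\mathfrak B}$ for all $x,y,z\in\mathfrak X$; (3) for every sequence $(x_n)$ and every $x$ in $\mathfrak X$, ${}_{\mathfrak A}\langle x_n|y\rangle\xrightarrow{\sigma}{}_{\mathfrak A}\langle x|y\rangle$ for all $y\in\mathfrak X$ if and only if $\langle x_n|y\rangle_{\mathfrak B}\xrightarrow{\sigma}\langle x|y\rangle_{\mathfrak B}$ for all $y\in\mathfrak X$. $\mathfrak A$ and $\mathfrak B$ are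 *strongly $\Sigma^*$-Morita equivalent* if such a bimodule exists. Let $\mathfrak C$ be a $\Sigma^*$-algebra, $p$ a projection in the multiplier algebra $M(\mathfrak C)$, and $p^\perp=1-p$. The corners $p\mathfrak Cp$ and $p^\perp\mathfrak Cp^\perp$, with the $\sigma$-convergence of $\mathfrak C$, are $\Sigma^*$-algebras. They are called *complementary $\sigma$-full corners of $\mathfrak C$* if $\mathscr B(\operatorname{span}\mathfrak Cp\,\mathfrak C)=\mathfrak C=\mathscr B(\operatorname{span}\mathfrak Cp^\perp\mathfrak C)$. **Theorem.** (a) Two $\Sigma^*$-algebras $\mathfrak A$ and $\mathfrak B$ are strongly $\Sigma^*$-Morita equivalent if and only if there are a $\Sigma^*$-algebra $\mathfrak C$ and a projection $p\in M(\mathfrak C)$ such that $p\mathfrak Cp$ and $p^\perp\mathfrak Cp^\perp$ are complementary $\sigma$-full corners of $\mathfrak C$, $\mathfrak A$ is $\Sigma^*$-isomorphic to $p\mathfrak Cp$, and $\mathfrak B$ is $\Sigma^*$-isomorphic to $p^\perp\mathfrak Cp^\perp$. (b) If $p\mathfrak Cp$ and $p^\perp\mathfrak Cp^\perp$ are complementary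 $\sigma$-full corners of a $\Sigma^*$-algebra $\mathfrak C$, then $p\mathfrak Cp^\perp$, with the module actions given by multiplication in $\mathfrak C$ and the inner products $\langle x|y\rangle_{p^\perp\mathfrak Cp^\perp}=x^*y$ and ${}_{p\mathfrak Cp}\langle x|y\rangle=xy^*$, is a $p\mathfrak Cp$-$p^\perp\mathfrak Cp^\perp$ $\Sigma^*$-imprimitivity bimodule. -/

import Mathlib

open Filter Topology
open scoped MultiplierAlgebra

universe u

noncomputable section

namespace SigmaStar

/-! ### Abstract Σ*-algebras -/

/-- Convergence of a sequence of bounded operators in the weak operator topology (WOT). -/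
def WOTTendsto {H : Type*} [NormedAddCommGroup H] [InnerProductSpace ℂ H]
    (T : ℕ → H →L[ℂ] H) (S : H →L[ℂ] H) : Prop :=
  Tendsto (fun n => ContinuousLinearMapWOT.ofCLM (T n)) atTop
    (𝓝 (ContinuousLinearMapWOT.ofCLM S))

/-- `π : A → B(H)` is a faithful nondegenerate representation whose range is closed under limits
of WOT-convergent sequences and for which the relation `conv` is exactly WOT-convergence in `B(H)`
of sequences in `A` to elements of `A`. -/
structure IsFaithfulSigmaRep {A : Type*} [NonUnitalCStarAlgebra A] (conv : (ℕ → A) → A → Prop)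
    {H : Type*} [NormedAddCommGroup H] [InnerProductSpace ℂ H] [CompleteSpace H]
    (π : A →⋆ₙₐ[ℂ] (H →L[ℂ] H)) : Prop where
  injective : Function.Injective π
  nondegenerate : (Submodule.span ℂ {η : H | ∃ a ζ, η = π a ζ}).topologicalClosure = ⊤
  range_closed : ∀ (b : ℕ → A) (T : H →L[ℂ] H), WOTTendsto (fun n => π (b n)) T → ∃ a, π a = T
  conv_iff : ∀ (b : ℕ → A) (a : A), conv b a ↔ WOTTendsto (fun n => π (b n)) (π a)

/-- An (abstract) Σ*-algebra: a C*-algebra together with a collection of pairs (sequence, limit),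
the σ-convergent sequences, which is the collection of WOT-convergent sequences in some faithful
representation as a concrete Σ*-algebra. (Asking for a Hilbert space in the universe of `A` is no
restriction: the direct sum of the GNS representations of the vector functionals of a given
faithful representation lives in the universe of `A` and has the same properties.) -/
class SigmaStarAlgebra (A : Type u) [NonUnitalCStarAlgebra A] where
  /-- `sigmaTendsto b a` means that the sequence `b` is σ-convergent to `a`. -/
  sigmaTendsto : (ℕ → A) → A → Prop
  exists_rep : ∃ (H : Type u) (_ : NormedAddCommGroup H) (_ : InnerProductSpace ℂ H)
    (_ : CompleteSpace H) (π : A →⋆ₙₐ[ℂ] (H →L[ℂ] H)), IsFaithfulSigmaRep sigmaTendsto π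


section Sigma

variable {A : Type*} [NonUnitalCStarAlgebra A] [SigmaStarAlgebra A]

/-- `S` is closed under limits of σ-convergent sequences. -/
def IsSigmaClosed (S : Set A) : Prop :=
  ∀ (b : ℕ → A) (a : A), (∀ n, b n ∈ S) → SigmaStarAlgebra.sigmaTendsto b a → a ∈ S

/-- The smallest σ-closed subset containing `S`. -/
def sigmaClosure (S : Set A) : Set A :=
  ⋂₀ {T | IsSigmaClosed T ∧ S ⊆ T}

/-- `S` is σ-dense: the smallest σ-closed subset containing `S` is everything. -/
def IsSigmaDense (S : Set A) : Prop :=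
  sigmaClosure S = Set.univ

/-- σ-continuity of a map between Σ*-algebras. -/
def SigmaContinuous {B : Type*} [NonUnitalCStarAlgebra B] [SigmaStarAlgebra B] (f : A → B) : Prop :=
  ∀ (b : ℕ → A) (a : A), SigmaStarAlgebra.sigmaTendsto b a →
    SigmaStarAlgebra.sigmaTendsto (fun n => f (b n)) (f a)

end Sigma

/-- Two Σ*-algebras are Σ*-isomorphic: there is a *-isomorphism that is σ-continuous in both
directions. -/
def SigmaIsomorphic (A B : Type*) [NonUnitalCStarAlgebra A] [SigmaStarAlgebra A]
    [NonUnitalCStarAlgebra B] [SigmaStarAlgebra B] : Prop :=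
  ∃ φ : A ≃⋆ₐ[ℂ] B, SigmaContinuous φ ∧ SigmaContinuous φ.symm

/-! ### C*-modules, Σ*-modules and imprimitivity bimodules

`CStarModule` of Mathlib is one-sided (left action, inner product linear in the second variable),
so both the left and the right notion, with the usual conventions, are spelled out here. -/

section Modules

/-- A left C*-module structure over the C*-algebra `A` on the complex vector space `X`. The inner
product is linear in the first and conjugate linear in the second variable. -/
structure LeftCStarModule (A X : Type*) [NonUnitalCStarAlgebra A] [AddCommGroup X] [Module ℂ X] where
  /-- The module action `(a, x) ↦ a x`. -/
  act : A →ₗ[ℂ] X →ₗ[ℂ] X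
  /-- The `A`-valued inner product. -/
  inner : X →ₗ[ℂ] X →ₗ⋆[ℂ] A
  mul_act : ∀ a b x, act (a * b) x = act a (act b x)
  inner_act : ∀ a x y, inner (act a x) y = a * inner x y
  star_inner : ∀ x y, star (inner x y) = inner y x
  inner_self_nonneg : ∀ x, ∃ a, inner x x = star a * a
  inner_self_eq_zero : ∀ x, inner x x = 0 → x = 0
  /-- `X` is complete in the norm `x ↦ ‖⟨x|x⟩‖ ^ (1 / 2)`. -/
  complete : ∀ u : ℕ → X,
    (∀ ε > 0, ∃ N, ∀ m ≥ N, ∀ n ≥ N, √‖inner (u m - u n) (u m - u n)‖ < ε) →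
      ∃ x, Tendsto (fun n => √‖inner (u n - x) (u n - x)‖) atTop (𝓝 0)

/-- A right C*-module structure over the C*-algebra `B` on the complex vector space `X`. The inner
product is conjugate linear in the first and linear in the second variable. -/
structure RightCStarModule (B X : Type*) [NonUnitalCStarAlgebra B] [AddCommGroup X]
    [Module ℂ X] where
  /-- The module action `(x, b) ↦ x b`. -/
  act : X →ₗ[ℂ] B →ₗ[ℂ] X
  /-- The `B`-valued inner product. -/
  inner : X →ₗ⋆[ℂ] X →ₗ[ℂ] B
  act_mul : ∀ x a b, act x (a * b) = act (act x a) b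
  inner_act : ∀ x y b, inner x (act y b) = inner x y * b
  star_inner : ∀ x y, star (inner x y) = inner y x
  inner_self_nonneg : ∀ x, ∃ b, inner x x = star b * b
  inner_self_eq_zero : ∀ x, inner x x = 0 → x = 0
  /-- `X` is complete in the norm `x ↦ ‖⟨x|x⟩‖ ^ (1 / 2)`. -/
  complete : ∀ u : ℕ → X,
    (∀ ε > 0, ∃ N, ∀ m ≥ N, ∀ n ≥ N, √‖inner (u m - u n) (u m - u n)‖ < ε) →
      ∃ x, Tendsto (fun n => √‖inner (u n - x) (u n - x)‖) atTop (𝓝 0)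

variable {A B X : Type*} [NonUnitalCStarAlgebra A] [SigmaStarAlgebra A]
  [NonUnitalCStarAlgebra B] [SigmaStarAlgebra B] [AddCommGroup X] [Module ℂ X]

/-- `x_n → x` means that `⟨x_n|y⟩` is σ-convergent to `⟨x|y⟩` for all `y`. -/
def LeftCStarModule.ModTendsto (L : LeftCStarModule A X) (u : ℕ → X) (x : X) : Prop :=
  ∀ y, SigmaStarAlgebra.sigmaTendsto (fun n => L.inner (u n) y) (L.inner x y)

/-- `x_n → x` means that `⟨x_n|y⟩` is σ-convergent to `⟨x|y⟩` for all `y`. -/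
def RightCStarModule.ModTendsto (R : RightCStarModule B X) (u : ℕ → X) (x : X) : Prop :=
  ∀ y, SigmaStarAlgebra.sigmaTendsto (fun n => R.inner (u n) y) (R.inner x y)

/-- A left C*-module over a Σ*-algebra is a left Σ*-module if whenever `⟨x_n|y⟩` is σ-convergent
for all `y`, there is an `x` with `⟨x_n|y⟩` σ-convergent to `⟨x|y⟩` for all `y`. -/
def LeftCStarModule.IsSigmaModule (L : LeftCStarModule A X) : Prop :=
  ∀ u : ℕ → X, (∀ y, ∃ a, SigmaStarAlgebra.sigmaTendsto (fun n => L.inner (u n) y) a) →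
    ∃ x, L.ModTendsto u x

/-- A right C*-module over a Σ*-algebra is a right Σ*-module if whenever `⟨x_n|y⟩` is σ-convergent
for all `y`, there is an `x` with `⟨x_n|y⟩` σ-convergent to `⟨x|y⟩` for all `y`. -/
def RightCStarModule.IsSigmaModule (R : RightCStarModule B X) : Prop :=
  ∀ u : ℕ → X, (∀ y, ∃ b, SigmaStarAlgebra.sigmaTendsto (fun n => R.inner (u n) y) b) →
    ∃ x, R.ModTendsto u x

/-- The linear span of the inner products is σ-dense. -/
def LeftCStarModule.IsSigmaFull (L : LeftCStarModule A X) : Prop :=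
  IsSigmaDense (Submodule.span ℂ {a : A | ∃ x y, a = L.inner x y} : Set A)

/-- The linear span of the inner products is σ-dense. -/
def RightCStarModule.IsSigmaFull (R : RightCStarModule B X) : Prop :=
  IsSigmaDense (Submodule.span ℂ {b : B | ∃ x y, b = R.inner x y} : Set B)

/-- `X`, with the left `A`-structure `L` and the right `B`-structure `R`, is an `A`-`B`
Σ*-imprimitivity bimodule. -/
structure IsImprimitivityBimodule (L : LeftCStarModule A X) (R : RightCStarModule B X) : Prop where
  act_assoc : ∀ a x b, R.act (L.act a x) b = L.act a (R.act x b)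
  left_isSigmaModule : L.IsSigmaModule
  left_isSigmaFull : L.IsSigmaFull
  right_isSigmaModule : R.IsSigmaModule
  right_isSigmaFull : R.IsSigmaFull
  inner_act_eq : ∀ x y z, L.act (L.inner x y) z = R.act x (R.inner y z)
  modTendsto_iff : ∀ (u : ℕ → X) (x : X), L.ModTendsto u x ↔ R.ModTendsto u x

end Modules

/-- Strong Σ*-Morita equivalence: there exists an `A`-`B` Σ*-imprimitivity bimodule. -/
def StronglyMoritaEquivalent (A B : Type u) [NonUnitalCStarAlgebra A] [SigmaStarAlgebra A]
    [NonUnitalCStarAlgebra B] [SigmaStarAlgebra B] : Prop :=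
  ∃ (X : Type u) (_ : AddCommGroup X) (_ : Module ℂ X) (L : LeftCStarModule A X)
    (R : RightCStarModule B X), IsImprimitivityBimodule L R

/-! ### Σ*-subalgebras -/

section Subalgebra

variable {C : Type u} [NonUnitalCStarAlgebra C] [SigmaStarAlgebra C]

lemma wotTendsto_iff {H : Type*} [NormedAddCommGroup H] [InnerProductSpace ℂ H] [CompleteSpace H]
    {T : ℕ → H →L[ℂ] H} {S : H →L[ℂ] H} :
    WOTTendsto T S ↔ ∀ x y : H, Tendsto (fun n => inner ℂ y (T n x)) atTop (𝓝 (inner ℂ y (S x))) :=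
  ContinuousLinearMapWOT.tendsto_iff_forall_inner_apply_tendsto

lemma inner_rep_left {A H : Type*} [NonUnitalCStarAlgebra A] [NormedAddCommGroup H]
    [InnerProductSpace ℂ H] [CompleteSpace H] (π : A →⋆ₙₐ[ℂ] (H →L[ℂ] H)) (a : A) (x y : H) :
    inner ℂ (π (star a) x) y = inner ℂ x (π a y) := by
  rw [map_star, ContinuousLinearMap.star_eq_adjoint, ContinuousLinearMap.adjoint_inner_left]

/-- A C*-subalgebra that is closed under limits of σ-convergent sequences is a Σ*-algebra, with
the σ-convergence inherited from the ambient Σ*-algebra. -/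
@[reducible]
def sigmaStarSubalgebra (S : NonUnitalStarSubalgebra ℂ C) [IsClosed (S : Set C)]
    (hS : IsSigmaClosed (S : Set C)) : SigmaStarAlgebra S where
  sigmaTendsto b a := SigmaStarAlgebra.sigmaTendsto (fun n => (b n : C)) (a : C)
  exists_rep := by
    obtain ⟨H, _, _, _, π, hπ⟩ := SigmaStarAlgebra.exists_rep (A := C)
    let K : Submodule ℂ H := (Submodule.span ℂ {η : H | ∃ a : S, ∃ ζ, η = π a ζ}).topologicalClosure
    have hKc : IsClosed (K : Set H) := Submodule.isClosed_topologicalClosure _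
    have : CompleteSpace K := hKc.completeSpace_coe
    have hmem : ∀ (a : S) (ζ : H), π a ζ ∈ K := fun a ζ =>
      Submodule.le_topologicalClosure _ (Submodule.subset_span ⟨a, ζ, rfl⟩)
    have horth : ∀ η : H, (∀ (a : S) (ζ : H), inner ℂ (π a ζ) η = 0) → η ∈ Kᗮ := by
      intro η hη
      rw [Submodule.orthogonal_closure, Submodule.mem_orthogonal]
      intro u hu
      induction hu using Submodule.span_induction with
      | mem x hx => obtain ⟨a, ζ, rfl⟩ := hx; exact hη a ζ
      | zero => simp
      | add x y _ _ hx hy => rw [inner_add_left, hx, hy, add_zero]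
      | smul c x _ hx => rw [inner_smul_left, hx, mul_zero]
    have hkill : ∀ (a : S) (η : H), η ∈ Kᗮ → π a η = 0 := by
      intro a η hη
      rw [← inner_self_eq_zero (𝕜 := ℂ), ← inner_rep_left π]
      exact (Submodule.mem_orthogonal _ _).1 hη _ (hmem (star a) _)
    let ι : K →L[ℂ] H := K.subtypeL
    let r : S → (K →L[ℂ] K) := fun a => ((π a).comp ι).codRestrict K (fun ζ => hmem a ζ)
    have hr : ∀ (a : S) (ζ : K), ((r a ζ : K) : H) = π a ζ := fun a ζ => rfl
    let ρ : S →⋆ₙₐ[ℂ] (K →L[ℂ] K) :=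
      { toFun := r
        map_smul' := fun c a => by ext ζ; simp [hr]
        map_zero' := by ext ζ; simp [hr]
        map_add' := fun a b => by ext ζ; simp [hr]
        map_mul' := fun a b => by ext ζ; simp [hr]
        map_star' := fun a => by
          rw [ContinuousLinearMap.star_eq_adjoint, ContinuousLinearMap.eq_adjoint_iff]
          intro x y
          rw [Submodule.coe_inner, Submodule.coe_inner, hr, hr]
          exact inner_rep_left π (a : C) x y }
    have hρ : ∀ (a : S) (ζ : K), ((ρ a ζ : K) : H) = π a ζ := fun a ζ => rfl
    let P : H →L[ℂ] K := K.orthogonalProjectionOnto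
    have hP : ∀ (a : S) (ζ : H), π a ζ = π a (P ζ : H) := by
      intro a ζ
      have := hkill a _ (K.sub_starProjection_mem_orthogonal ζ)
      rw [map_sub, sub_eq_zero] at this
      exact this
    have key : ∀ (b : ℕ → S) (T : K →L[ℂ] K), WOTTendsto (fun n => ρ (b n)) T ↔
        WOTTendsto (fun n => π (b n)) (ι.comp (T.comp P)) := by
      intro b T
      rw [wotTendsto_iff, wotTendsto_iff]
      constructor
      · intro h x y
        have h1 := h (P x) (P y)
        have e : ∀ z : K, inner ℂ (P y) z = inner ℂ y (z : H) := fun z =>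
          Submodule.inner_orthogonalProjectionOnto_eq_of_mem_right z y
        simp only [e, hρ] at h1
        simp only [hP _ x]
        exact h1
      · intro h x y
        have h1 := h x y
        have : P (x : H) = x := Submodule.orthogonalProjectionOnto_mem_subspace_eq_self x
        simp only [ContinuousLinearMap.comp_apply, this] at h1
        exact h1
    have hcomp : ∀ a : S, ι.comp ((ρ a).comp P) = π a := by
      intro a
      ext ζ
      exact (hP a ζ).symm
    refine ⟨K, inferInstance, inferInstance, inferInstance, ρ, ?_, ?_, ?_, ?_⟩
    · intro a b hab
      apply Subtype.ext
      apply hπ.injective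
      rw [← hcomp a, ← hcomp b, hab]
    · rw [Submodule.topologicalClosure_eq_top_iff, Submodule.eq_bot_iff]
      intro η hη
      have h1 : ∀ (a : S) (ζ : K), inner ℂ (ρ a ζ) η = 0 := fun a ζ =>
        (Submodule.mem_orthogonal _ _).1 hη _ (Submodule.subset_span ⟨a, ζ, rfl⟩)
      have h2 : (η : H) ∈ Kᗮ := by
        apply horth
        intro a ζ
        rw [hP a ζ]
        exact h1 a (P ζ)
      have h3 := (Submodule.mem_orthogonal _ _).1 h2 _ η.2
      exact Subtype.ext (inner_self_eq_zero.1 h3)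
    · intro b T hT
      rw [key] at hT
      obtain ⟨c, hc⟩ := hπ.range_closed _ _ hT
      have hcS : c ∈ S := hS (fun n => (b n : C)) c (fun n => (b n).2)
        ((hπ.conv_iff _ _).2 (by rw [hc]; exact hT))
      refine ⟨⟨c, hcS⟩, ?_⟩
      have h4 : ι.comp ((ρ ⟨c, hcS⟩).comp P) = ι.comp (T.comp P) := by rw [hcomp]; exact hc
      ext x
      have h5 := congrArg (fun F : H →L[ℂ] H => F x) h4
      have : P (x : H) = x := Submodule.orthogonalProjectionOnto_mem_subspace_eq_self x
      simp only [ContinuousLinearMap.comp_apply, this] at h5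
      exact h5
    · intro b a
      rw [key, hcomp]
      exact hπ.conv_iff _ _

lemma sigmaTendsto_unique {b : ℕ → C} {a a' : C} (h : SigmaStarAlgebra.sigmaTendsto b a)
    (h' : SigmaStarAlgebra.sigmaTendsto b a') : a = a' := by
  obtain ⟨H, _, _, _, π, hπ⟩ := SigmaStarAlgebra.exists_rep (A := C)
  rw [hπ.conv_iff, wotTendsto_iff] at h h'
  apply hπ.injective
  ext x
  exact ext_inner_left ℂ fun y => tendsto_nhds_unique (h x y) (h' x y)

lemma sigmaTendsto_mul_mul {b : ℕ → C} {a : C} (h : SigmaStarAlgebra.sigmaTendsto b a) (d e : C) :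
    SigmaStarAlgebra.sigmaTendsto (fun n => d * b n * e) (d * a * e) := by
  obtain ⟨H, _, _, _, π, hπ⟩ := SigmaStarAlgebra.exists_rep (A := C)
  rw [hπ.conv_iff, wotTendsto_iff] at h ⊢
  intro x y
  have := h (π e x) (π (star d) y)
  simp only [inner_rep_left] at this
  simpa using this

end Subalgebra

/-! ### Corners -/

section Corners

variable {C : Type u} [NonUnitalCStarAlgebra C]

/-- The subspace `pCq` of `C`, for `p` and `q` in the multiplier algebra of `C`. Here
`p.fst c = pc` and `q.snd c = cq`. -/
def cornerSpace (p q : 𝓜(ℂ, C)) : Submodule ℂ C :=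
  LinearMap.range ((p.fst.comp q.snd : C →L[ℂ] C) : C →ₗ[ℂ] C)

lemma eq_of_mul_left {a b : C} (h : ∀ z, z * a = z * b) : a = b := by
  have : star (a - b) * (a - b) = 0 := by rw [mul_sub, h, sub_self]
  exact sub_eq_zero.1 ((CStarRing.star_mul_self_eq_zero_iff _).1 this)

lemma eq_of_mul_right {a b : C} (h : ∀ z, a * z = b * z) : a = b := by
  have : (a - b) * star (a - b) = 0 := by rw [sub_mul, h, sub_self]
  exact sub_eq_zero.1 ((CStarRing.mul_star_self_eq_zero_iff _).1 this)

lemma fst_mul (p : 𝓜(ℂ, C)) (a b : C) : p.fst (a * b) = p.fst a * b :=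
  eq_of_mul_left fun z => by rw [← p.central, ← mul_assoc, p.central, mul_assoc]

lemma snd_mul (p : 𝓜(ℂ, C)) (a b : C) : p.snd (a * b) = a * p.snd b :=
  eq_of_mul_right fun z => by rw [p.central, mul_assoc, ← p.central, mul_assoc]

lemma fst_snd_comm (p q : 𝓜(ℂ, C)) (c : C) : p.fst (q.snd c) = q.snd (p.fst c) :=
  eq_of_mul_right fun z => by
    rw [← fst_mul, q.central, q.central, fst_mul]

variable {p q : 𝓜(ℂ, C)}

lemma fst_fst (hp : IsStarProjection p) (c : C) : p.fst (p.fst c) = p.fst c := by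
  conv_rhs => rw [← hp.isIdempotentElem.eq]
  rfl

lemma snd_snd (hp : IsStarProjection p) (c : C) : p.snd (p.snd c) = p.snd c := by
  conv_rhs => rw [← hp.isIdempotentElem.eq]
  rfl

lemma star_fst_eq (hp : IsStarProjection p) (c : C) : star (p.fst c) = p.snd (star c) := by
  conv_rhs => rw [← hp.isSelfAdjoint.star_eq, DoubleCentralizer.star_snd, star_star]

lemma star_snd_eq (hp : IsStarProjection p) (c : C) : star (p.snd c) = p.fst (star c) := by
  conv_rhs => rw [← hp.isSelfAdjoint.star_eq, DoubleCentralizer.star_fst, star_star]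

lemma mem_cornerSpace (hp : IsStarProjection p) (hq : IsStarProjection q) {c : C} :
    c ∈ cornerSpace p q ↔ p.fst c = c ∧ q.snd c = c := by
  constructor
  · rintro ⟨d, rfl⟩
    change p.fst (p.fst (q.snd d)) = p.fst (q.snd d) ∧ q.snd (p.fst (q.snd d)) = p.fst (q.snd d)
    rw [fst_fst hp, ← fst_snd_comm, snd_snd hq]
    exact ⟨rfl, rfl⟩
  · rintro ⟨h1, h2⟩
    exact ⟨c, by change p.fst (q.snd c) = c; rw [h2, h1]⟩

lemma isClosed_cornerSpace (hp : IsStarProjection p) (hq : IsStarProjection q) :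
    IsClosed (cornerSpace p q : Set C) := by
  have : (cornerSpace p q : Set C) = {c | p.fst c = c} ∩ {c | q.snd c = c} := by
    ext c
    exact mem_cornerSpace hp hq
  rw [this]
  exact (isClosed_eq p.fst.continuous continuous_id).inter
    (isClosed_eq q.snd.continuous continuous_id)

lemma mul_mem_cornerSpace {r : 𝓜(ℂ, C)} (hp : IsStarProjection p) (hq : IsStarProjection q)
    (hr : IsStarProjection r) {x y : C} (hx : x ∈ cornerSpace p q) (hy : y ∈ cornerSpace q r) :
    x * y ∈ cornerSpace p r := by
  rw [mem_cornerSpace hp hq] at hx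
  rw [mem_cornerSpace hq hr] at hy
  rw [mem_cornerSpace hp hr, fst_mul, snd_mul, hx.1, hy.2]
  exact ⟨rfl, rfl⟩

lemma star_mem_cornerSpace (hp : IsStarProjection p) (hq : IsStarProjection q)
    {x : C} (hx : x ∈ cornerSpace p q) : star x ∈ cornerSpace q p := by
  rw [mem_cornerSpace hp hq] at hx
  rw [mem_cornerSpace hq hp, ← star_snd_eq hq, ← star_fst_eq hp, hx.1, hx.2]
  exact ⟨rfl, rfl⟩

/-- The corner `pCp`, as a C*-subalgebra of `C`. -/
def corner (p : 𝓜(ℂ, C)) (hp : IsStarProjection p) : NonUnitalStarSubalgebra ℂ C :=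
  { cornerSpace p p with
    mul_mem' := fun hx hy => mul_mem_cornerSpace hp hp hp hx hy
    star_mem' := fun hx => star_mem_cornerSpace hp hp hx }

instance isClosed_corner (hp : IsStarProjection p) : IsClosed (corner p hp : Set C) :=
  isClosed_cornerSpace hp hp

lemma isSigmaClosed_corner [SigmaStarAlgebra C] (hp : IsStarProjection p) :
    IsSigmaClosed (corner p hp : Set C) := by
  intro b a hb h
  refine (mem_cornerSpace hp hp).2 ⟨?_, ?_⟩
  · refine eq_of_mul_left fun z => eq_of_mul_right fun w => ?_
    have h1 := sigmaTendsto_mul_mul h (p.snd z) w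
    have h2 := sigmaTendsto_mul_mul h z w
    have e : ∀ n, p.snd z * b n * w = z * b n * w := fun n => by
      rw [p.central, ((mem_cornerSpace hp hp).1 (hb n)).1]
    simp only [e] at h1
    rw [← p.central]
    exact sigmaTendsto_unique h1 h2
  · refine eq_of_mul_left fun z => eq_of_mul_right fun w => ?_
    have h1 := sigmaTendsto_mul_mul h z (p.fst w)
    have h2 := sigmaTendsto_mul_mul h z w
    have e : ∀ n, z * b n * p.fst w = z * b n * w := fun n => by
      rw [mul_assoc, ← p.central, ((mem_cornerSpace hp hp).1 (hb n)).2, mul_assoc]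
    simp only [e] at h1
    rw [mul_assoc, p.central, ← mul_assoc]
    exact sigmaTendsto_unique h1 h2

/-- The corner `pCp` is a Σ*-algebra with the σ-convergence of `C`. -/
instance cornerSigmaStarAlgebra [SigmaStarAlgebra C] (hp : IsStarProjection p) :
    SigmaStarAlgebra (corner p hp) :=
  sigmaStarSubalgebra (corner p hp) (isSigmaClosed_corner hp)

lemma exists_sqrt_mem_corner (hp : IsStarProjection p) {a b : C} (ha : a ∈ corner p hp)
    (hab : a = star b * b) : ∃ s : C, s ∈ corner p hp ∧ a = star s * s := by
  let := CStarAlgebra.spectralOrder C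
  have := CStarAlgebra.spectralOrderedRing C
  have hnn : 0 ≤ a := hab ▸ star_mul_self_nonneg b
  have hss : CFC.sqrt a * CFC.sqrt a = a := CFC.sqrt_mul_sqrt_self a
  have hsa : star (CFC.sqrt a) = CFC.sqrt a := (CFC.sqrt_nonneg a).isSelfAdjoint.star_eq
  generalize CFC.sqrt a = s at hss hsa
  have hpa := (mem_cornerSpace hp hp).1 ha
  have h1 : s = p.snd s := by
    rw [← sub_eq_zero, ← CStarRing.star_mul_self_eq_zero_iff, star_sub, star_snd_eq hp, hsa,
      sub_mul, mul_sub, mul_sub, ← snd_mul, hss, hpa.2, sub_self, zero_sub, ← snd_mul, ← fst_mul,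
      hss, hpa.1, hpa.2, sub_self, neg_zero]
  have h2 : s = p.fst s := by
    conv_lhs => rw [← hsa, h1, star_snd_eq hp, hsa]
  exact ⟨s, (mem_cornerSpace hp hp).2 ⟨h2.symm, h1.symm⟩, by rw [hsa, hss]⟩

lemma exists_limit_cornerSpace (hp : IsStarProjection p) (hq : IsStarProjection q)
    (u : ℕ → cornerSpace p q)
    (hu : ∀ ε > 0, ∃ N, ∀ m ≥ N, ∀ n ≥ N, ‖u m - u n‖ < ε) :
    ∃ x, Tendsto (fun n => ‖u n - x‖) atTop (𝓝 0) := by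
  have : CompleteSpace (cornerSpace p q) := (isClosed_cornerSpace hp hq).completeSpace_coe
  have hc : CauchySeq u := by
    rw [Metric.cauchySeq_iff]
    intro ε hε
    obtain ⟨N, hN⟩ := hu ε hε
    exact ⟨N, fun m hm n hn => by rw [dist_eq_norm]; exact hN m hm n hn⟩
  obtain ⟨x, hx⟩ := cauchySeq_tendsto_of_complete hc
  exact ⟨x, tendsto_iff_norm_sub_tendsto_zero.1 hx⟩

/-- `pCq` as a left C*-module over `pCp`: the action is the multiplication of `C` and
`⟨x|y⟩ = x y*`. -/
def leftCornerModule (hp : IsStarProjection p) (hq : IsStarProjection q) :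
    LeftCStarModule (corner p hp) (cornerSpace p q) where
  act := LinearMap.mk₂ ℂ (fun a x => ⟨(a : C) * (x : C), mul_mem_cornerSpace hp hp hq a.2 x.2⟩)
    (fun a b x => Subtype.ext (add_mul _ _ _)) (fun c a x => Subtype.ext (smul_mul_assoc _ _ _))
    (fun a x y => Subtype.ext (mul_add _ _ _)) (fun c a x => Subtype.ext (mul_smul_comm _ _ _))
  inner := LinearMap.mk₂'ₛₗ (RingHom.id ℂ) (starRingEnd ℂ)
    (fun x y => ⟨(x : C) * star (y : C),
      mul_mem_cornerSpace hp hq hp x.2 (star_mem_cornerSpace hp hq y.2)⟩)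
    (fun x y z => Subtype.ext (add_mul _ _ _))
    (fun c x y => Subtype.ext (smul_mul_assoc _ _ _))
    (fun x y z => Subtype.ext (by simp [mul_add]))
    (fun c x y => Subtype.ext (by simp [mul_smul_comm]))
  mul_act a b x := Subtype.ext (mul_assoc _ _ _)
  inner_act a x y := Subtype.ext (mul_assoc _ _ _)
  star_inner x y := Subtype.ext (by simp)
  inner_self_nonneg x := by
    obtain ⟨s, hs, h⟩ := exists_sqrt_mem_corner hp (a := (x : C) * star (x : C)) (b := star (x : C))
      (mul_mem_cornerSpace hp hq hp x.2 (star_mem_cornerSpace hp hq x.2)) (by rw [star_star])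
    exact ⟨⟨s, hs⟩, Subtype.ext h⟩
  inner_self_eq_zero x h :=
    Subtype.ext ((CStarRing.mul_star_self_eq_zero_iff (x : C)).1 (congrArg Subtype.val h))
  complete u hu := by
    have e : ∀ x : cornerSpace p q, √‖(x : C) * star (x : C)‖ = ‖x‖ := fun x => by
      rw [CStarRing.norm_self_mul_star, Real.sqrt_mul_self (norm_nonneg _)]; rfl
    obtain ⟨x, hx⟩ := exists_limit_cornerSpace hp hq u fun ε hε => by
      obtain ⟨N, hN⟩ := hu ε hε
      exact ⟨N, fun m hm n hn => by rw [← e]; exact hN m hm n hn⟩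
    exact ⟨x, hx.congr fun n => (e _).symm⟩

/-- `pCq` as a right C*-module over `qCq`: the action is the multiplication of `C` and
`⟨x|y⟩ = x* y`. -/
def rightCornerModule (hp : IsStarProjection p) (hq : IsStarProjection q) :
    RightCStarModule (corner q hq) (cornerSpace p q) where
  act := LinearMap.mk₂ ℂ (fun x b => ⟨(x : C) * (b : C), mul_mem_cornerSpace hp hq hq x.2 b.2⟩)
    (fun a b x => Subtype.ext (add_mul _ _ _)) (fun c a x => Subtype.ext (smul_mul_assoc _ _ _))
    (fun a x y => Subtype.ext (mul_add _ _ _)) (fun c a x => Subtype.ext (mul_smul_comm _ _ _))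
  inner := LinearMap.mk₂'ₛₗ (starRingEnd ℂ) (RingHom.id ℂ)
    (fun x y => ⟨star (x : C) * (y : C),
      mul_mem_cornerSpace hq hp hq (star_mem_cornerSpace hp hq x.2) y.2⟩)
    (fun x y z => Subtype.ext (by simp [add_mul]))
    (fun c x y => Subtype.ext (by simp [smul_mul_assoc]))
    (fun x y z => Subtype.ext (mul_add _ _ _))
    (fun c x y => Subtype.ext (mul_smul_comm _ _ _))
  act_mul x a b := Subtype.ext (mul_assoc _ _ _).symm
  inner_act x y b := Subtype.ext (mul_assoc _ _ _).symm
  star_inner x y := Subtype.ext (by simp)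
  inner_self_nonneg x := by
    obtain ⟨s, hs, h⟩ := exists_sqrt_mem_corner hq (a := star (x : C) * (x : C)) (b := (x : C))
      (mul_mem_cornerSpace hq hp hq (star_mem_cornerSpace hp hq x.2) x.2) rfl
    exact ⟨⟨s, hs⟩, Subtype.ext h⟩
  inner_self_eq_zero x h :=
    Subtype.ext ((CStarRing.star_mul_self_eq_zero_iff (x : C)).1 (congrArg Subtype.val h))
  complete u hu := by
    have e : ∀ x : cornerSpace p q, √‖star (x : C) * (x : C)‖ = ‖x‖ := fun x => by
      rw [CStarRing.norm_star_mul_self, Real.sqrt_mul_self (norm_nonneg _)]; rfl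
    obtain ⟨x, hx⟩ := exists_limit_cornerSpace hp hq u fun ε hε => by
      obtain ⟨N, hN⟩ := hu ε hε
      exact ⟨N, fun m hm n hn => by rw [← e]; exact hN m hm n hn⟩
    exact ⟨x, hx.congr fun n => (e _).symm⟩

/-- The ideal `CpC` of `C`: the linear span of the products `c p d`. -/
def cornerIdeal (p : 𝓜(ℂ, C)) : Submodule ℂ C :=
  Submodule.span ℂ {a | ∃ c d, a = c * p.fst d}

/-- The corners `pCp` and `(1 - p)C(1 - p)` are (complementary) σ-full corners of `C`. -/
def ComplementarySigmaFull [SigmaStarAlgebra C] (p : 𝓜(ℂ, C)) : Prop :=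
  IsSigmaDense (cornerIdeal p : Set C) ∧ IsSigmaDense (cornerIdeal (1 - p) : Set C)

end Corners

end SigmaStar

end

noncomputable section

namespace SigmaStar

open SigmaStarAlgebra

/-! ### Sequences in the weak operator topology -/

section WOT

variable {H : Type*} [NormedAddCommGroup H] [InnerProductSpace ℂ H]

/-! From corners to bimodules, the point is that convergence in the module is σ-convergence in C.
Write q for the complementary projection. If CpC is σ-dense and (u_n) in pCq is such that u_n y* is
σ-convergent for every y in pCq, then (u_n) itself σ-converges (`exists_sigmaTendsto_cornerSpace`).
Uniform boundedness bounds the sequence. In a concrete representation, the matrix coefficients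
converge on the vectors wζ for which (u_n w) converges, and every u_n vanishes on the orthogonal
complement of these vectors (`exists_sigmaTendsto_of_mul`). So both inner products of pCq induce the
σ-convergence of C, which gives the Σ*-module property and the compatibility axiom. Fullness follows
by compressing CqC to pCp. Pulling this bimodule back along Σ*-isomorphisms gives one direction of
the equivalence.

For the other direction, the linking algebra is built concretely. Let ρ represent B on V, and let H
be the interior tensor product of X and V, with creation operators T x : V → H satisfying T_x* T_y =
ρ(⟨x|y⟩) (`exists_tensor`). The left action of A induces a representation σ on H with σ(⟨x|y⟩) = T_x
T_y*. The crux is `isFaithfulSigmaRep_leftRep`: σ realizes A with its given σ-convergence. There the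
compatibility of the two module convergences carries limits between A and B, and
`exists_sigmaTendsto_of_mul` again produces limits, now from left fullness.

The 2×2 operator matrices on H ⊕ V with entries in σ(A), T(X), T(X)* and ρ(B) form a *-algebra that
is sequentially WOT-closed, because each entry space is (`mem_algebra_of_wotTendsto`). The
projection onto H is a multiplier whose corners are A and B, and the products T_x* T_y and T_x T_y*
make both corners σ-full (`complementarySigmaFull`). -/

lemma cauchySeq_of_mem_closure_span {E : Type*} [NormedAddCommGroup E] [NormedSpace ℂ E]
    {f : ℕ → E →L[ℂ] ℂ} {M : ℝ} (hM : ∀ n, ‖f n‖ ≤ M) {s : Set E}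
    (hs : ∀ x ∈ s, CauchySeq fun n => f n x) {x : E}
    (hx : x ∈ (Submodule.span ℂ s).topologicalClosure) : CauchySeq fun n => f n x := by
  have hM0 : 0 ≤ M := (norm_nonneg _).trans (hM 0)
  have hspan : ∀ y ∈ Submodule.span ℂ s, CauchySeq fun n => f n y := by
    intro y hy
    induction hy using Submodule.span_induction with
    | mem y hy => exact hs y hy
    | zero => simpa using cauchySeq_const (0 : ℂ)
    | add y z _ _ hy hz => simpa [Pi.add_def] using hy.add hz
    | smul c y _ hy =>
      simpa [Function.comp_def] using (uniformContinuous_const_smul c).comp_cauchySeq hy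
  rw [Metric.cauchySeq_iff]
  intro ε hε
  -- `M` may be zero, hence the denominator with `M + 1`.
  obtain ⟨y, hy, hxy⟩ := Metric.mem_closure_iff.1
    (show x ∈ closure (Submodule.span ℂ s : Set E) from hx) (ε / (4 * (M + 1))) (by positivity)
  obtain ⟨N, hN⟩ := Metric.cauchySeq_iff.1 (hspan y hy) (ε / 2) (by positivity)
  have key : ∀ n, ‖f n x - f n y‖ ≤ ε / 4 := fun n => by
    rw [← map_sub]
    calc ‖f n (x - y)‖ ≤ ‖f n‖ * ‖x - y‖ := (f n).le_opNorm _
      _ ≤ (M + 1) * (ε / (4 * (M + 1))) := by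
        gcongr
        · linarith [hM n]
        · rw [← dist_eq_norm]; exact hxy.le
      _ = ε / 4 := by field_simp
  refine ⟨N, fun m hm n hn => ?_⟩
  have h1 := hN m hm n hn
  rw [dist_eq_norm] at h1 ⊢
  have e : f m x - f n x = (f m x - f m y) + (f m y - f n y) - (f n x - f n y) := by ring
  rw [e]
  calc _ ≤ ‖f m x - f m y‖ + ‖f m y - f n y‖ + ‖f n x - f n y‖ :=
        (norm_sub_le _ _).trans (by gcongr; exact norm_add_le _ _)
    _ < ε := by linarith [key m, key n]

lemma topologicalClosure_span_univ :
    (Submodule.span ℂ (Set.univ : Set H)).topologicalClosure = ⊤ := by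
  rw [Submodule.span_univ, eq_top_iff]
  exact Submodule.le_topologicalClosure _

variable [CompleteSpace H]

/-- A WOT-convergent sequence of operators is bounded. -/
lemma WOTTendsto.bounded {T : ℕ → H →L[ℂ] H} {S : H →L[ℂ] H} (h : WOTTendsto T S) :
    ∃ M, ∀ n, ‖T n‖ ≤ M := by
  rw [wotTendsto_iff] at h
  -- Uniform boundedness is used twice: for the operators, and for fixed x for the functionals ⟨T_n
  -- x|·⟩.
  apply banach_steinhaus
  intro x
  obtain ⟨M, hM⟩ := banach_steinhaus (g := fun n => innerSL ℂ (T n x)) fun y => by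
    have h1 := (h x y).norm.bddAbove_range
    obtain ⟨M, hM⟩ := h1
    refine ⟨M, fun n => ?_⟩
    rw [innerSL_apply_apply, norm_inner_symm]
    exact hM ⟨n, rfl⟩
  exact ⟨M, fun n => by simpa using hM n⟩

lemma WOTTendsto.unique {T : ℕ → H →L[ℂ] H} {S S' : H →L[ℂ] H} (h : WOTTendsto T S)
    (h' : WOTTendsto T S') : S = S' := by
  rw [wotTendsto_iff] at h h'
  ext x
  exact ext_inner_left ℂ fun y => tendsto_nhds_unique (h x y) (h' x y)

lemma WOTTendsto.star {T : ℕ → H →L[ℂ] H} {S : H →L[ℂ] H} (h : WOTTendsto T S) :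
    WOTTendsto (fun n => star (T n)) (star S) := by
  rw [wotTendsto_iff] at h ⊢
  intro x y
  simp only [ContinuousLinearMap.star_eq_adjoint, ContinuousLinearMap.adjoint_inner_right]
  have := (Complex.continuous_conj.tendsto _).comp (h y x)
  simpa [Function.comp_def, inner_conj_symm] using this

/-- Compression of WOT-convergent sequences between possibly different Hilbert spaces. -/
lemma WOTTendsto.adjoint_comp_comp {K : Type*} [NormedAddCommGroup K] [InnerProductSpace ℂ K]
    [CompleteSpace K] {T : ℕ → H →L[ℂ] H} {S : H →L[ℂ] H} (h : WOTTendsto T S)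
    (V W : K →L[ℂ] H) :
    WOTTendsto (fun n => V.adjoint ∘L T n ∘L W) (V.adjoint ∘L S ∘L W) := by
  rw [wotTendsto_iff] at h ⊢
  intro x y
  simpa [ContinuousLinearMap.adjoint_inner_right] using h (W x) (V y)

lemma wotTendsto_of_tendsto {T : ℕ → H →L[ℂ] H} {S : H →L[ℂ] H} (h : Tendsto T atTop (𝓝 S)) :
    WOTTendsto T S := by
  rw [wotTendsto_iff]
  intro x y
  have h1 : Tendsto (fun n => T n x) atTop (𝓝 (S x)) :=
    ((ContinuousLinearMap.apply ℂ H x).continuous.tendsto S).comp h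
  exact tendsto_const_nhds.inner h1

/-- The norm bound lets the Cauchy condition spread from the total sets to all of H, one variable at
a time. The limit of the forms ⟨y|T_n x⟩ is then a sesquilinear form bounded by `M`, and Riesz
representation turns it into an operator. -/
lemma exists_wotTendsto_of_cauchySeq {T : ℕ → H →L[ℂ] H} {M : ℝ} (hM : ∀ n, ‖T n‖ ≤ M)
    {D D' : Set H} (hD : (Submodule.span ℂ D).topologicalClosure = ⊤)
    (hD' : (Submodule.span ℂ D').topologicalClosure = ⊤)
    (h : ∀ x ∈ D, ∀ y ∈ D', CauchySeq fun n => inner ℂ y (T n x)) :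
    ∃ S, WOTTendsto T S := by
  have hM0 : 0 ≤ M := (norm_nonneg _).trans (hM 0)
  have conj_iff : ∀ x y : H, (CauchySeq fun n => inner ℂ y (T n x)) →
      CauchySeq fun n => inner ℂ (T n x) y := fun x y hc => by
    have := Complex.isometry_conj.uniformContinuous.comp_cauchySeq hc
    simpa [Function.comp_def, inner_conj_symm] using this
  have conj_iff' : ∀ x y : H, (CauchySeq fun n => inner ℂ (T n x) y) →
      CauchySeq fun n => inner ℂ y (T n x) := fun x y hc => by
    have := Complex.isometry_conj.uniformContinuous.comp_cauchySeq hc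
    simpa [Function.comp_def, inner_conj_symm] using this
  have h1 : ∀ x ∈ D, ∀ y, CauchySeq fun n => inner ℂ y (T n x) := by
    intro x hx y
    apply conj_iff'
    refine cauchySeq_of_mem_closure_span (f := fun n => innerSL ℂ (T n x)) (M := M * ‖x‖)
      (s := D') (fun n => ?_) (fun y hy => conj_iff _ _ (h x hx y hy)) (by rw [hD']; trivial)
    rw [innerSL_apply_norm]
    exact (T n).le_of_opNorm_le (hM n) x
  have h2 : ∀ x y, CauchySeq fun n => inner ℂ y (T n x) := by
    intro x y
    refine cauchySeq_of_mem_closure_span (f := fun n => (innerSL ℂ y).comp (T n)) (M := ‖y‖ * M)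
      (s := D) (fun n => ?_) (fun x hx => h1 x hx y) (by rw [hD]; trivial)
    refine (ContinuousLinearMap.opNorm_comp_le _ _).trans ?_
    rw [innerSL_apply_norm]
    gcongr
    exact hM n
  choose l hl using fun x y => cauchySeq_tendsto_of_complete (h2 x y)
  let B : H →L⋆[ℂ] H →L[ℂ] ℂ := LinearMap.mkContinuous₂
    (LinearMap.mk₂'ₛₗ (starRingEnd ℂ) (RingHom.id ℂ) (fun y x => l x y)
      (fun y y' x => tendsto_nhds_unique (hl x (y + y')) (by
        simpa [inner_add_left] using (hl x y).add (hl x y')))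
      (fun c y x => tendsto_nhds_unique (hl x (c • y)) (by
        simpa [inner_smul_left, mul_comm] using (hl x y).const_mul (starRingEnd ℂ c)))
      (fun y x x' => tendsto_nhds_unique (hl (x + x') y) (by
        simpa [inner_add_right] using (hl x y).add (hl x' y)))
      (fun c y x => tendsto_nhds_unique (hl (c • x) y) (by
        simpa [inner_smul_right] using (hl x y).const_mul c)))
    M (fun y x => by
      refine le_of_tendsto (hl x y).norm (Eventually.of_forall fun n => ?_)
      calc ‖inner ℂ y (T n x)‖ ≤ ‖y‖ * ‖T n x‖ := norm_inner_le_norm _ _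
        _ ≤ ‖y‖ * (M * ‖x‖) := by gcongr; exact (T n).le_of_opNorm_le (hM n) x
        _ = M * ‖y‖ * ‖x‖ := by ring)
  -- The Riesz operator of `B` acts on the conjugate linear variable y, so the limit operator is its
  -- adjoint.
  refine ⟨(InnerProductSpace.continuousLinearMapOfBilin B).adjoint, ?_⟩
  rw [wotTendsto_iff]
  intro x y
  rw [ContinuousLinearMap.adjoint_inner_right, InnerProductSpace.continuousLinearMapOfBilin_apply]
  exact hl x y

/-- WOT-convergence of a bounded sequence can be checked on total sets. -/
lemma wotTendsto_of_total {T : ℕ → H →L[ℂ] H} {S : H →L[ℂ] H} {M : ℝ} (hM : ∀ n, ‖T n‖ ≤ M)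
    {D D' : Set H} (hD : (Submodule.span ℂ D).topologicalClosure = ⊤)
    (hD' : (Submodule.span ℂ D').topologicalClosure = ⊤)
    (h : ∀ x ∈ D, ∀ y ∈ D', Tendsto (fun n => inner ℂ y (T n x)) atTop (𝓝 (inner ℂ y (S x)))) :
    WOTTendsto T S := by
  obtain ⟨S', hS'⟩ := exists_wotTendsto_of_cauchySeq hM hD hD' fun x hx y hy =>
    (h x hx y hy).cauchySeq
  suffices S' = S by rwa [this] at hS'
  refine ContinuousLinearMap.ext_on
    (Submodule.dense_iff_topologicalClosure_eq_top.2 hD) fun x hx => ?_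
  have h1 : S' x - S x ∈ ((Submodule.span ℂ D').topologicalClosure)ᗮ := by
    rw [Submodule.orthogonal_closure, Submodule.mem_orthogonal]
    intro y hy
    induction hy using Submodule.span_induction with
    | mem y hy =>
      rw [inner_sub_right, sub_eq_zero]
      exact tendsto_nhds_unique (wotTendsto_iff.1 hS' x y) (h x hx y hy)
    | zero => simp
    | add y z _ _ hy hz => rw [inner_add_left, hy, hz, add_zero]
    | smul c y _ hy => rw [inner_smul_left, hy, mul_zero]
  rw [hD', Submodule.top_orthogonal_eq_bot, Submodule.mem_bot, sub_eq_zero] at h1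
  exact h1

end WOT

/-! ### Calculus of σ-convergence -/

section Calculus

variable {C : Type u} [NonUnitalCStarAlgebra C]

lemma IsFaithfulSigmaRep.norm_map {conv : (ℕ → C) → C → Prop} {H : Type*} [NormedAddCommGroup H]
    [InnerProductSpace ℂ H] [CompleteSpace H] {π : C →⋆ₙₐ[ℂ] (H →L[ℂ] H)}
    (hπ : IsFaithfulSigmaRep conv π) (c : C) : ‖π c‖ = ‖c‖ :=
  NonUnitalStarAlgHom.norm_map π hπ.injective c

/-- A vector killed by a nondegenerate representation is zero. -/
lemma IsFaithfulSigmaRep.eq_zero_of_forall {conv : (ℕ → C) → C → Prop} {H : Type*}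
    [NormedAddCommGroup H] [InnerProductSpace ℂ H] [CompleteSpace H] {π : C →⋆ₙₐ[ℂ] (H →L[ℂ] H)}
    (hπ : IsFaithfulSigmaRep conv π) {ξ : H} (h : ∀ c, π c ξ = 0) : ξ = 0 := by
  have h1 : ξ ∈ (Submodule.span ℂ {η : H | ∃ a ζ, η = π a ζ}).topologicalClosureᗮ := by
    rw [Submodule.orthogonal_closure, Submodule.mem_orthogonal]
    intro y hy
    induction hy using Submodule.span_induction with
    | mem y hy =>
      obtain ⟨a, ζ, rfl⟩ := hy
      have := inner_rep_left π (star a) ζ ξ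
      rwa [star_star, h, inner_zero_right] at this
    | zero => simp
    | add y z _ _ hy hz => rw [inner_add_left, hy, hz, add_zero]
    | smul c y _ hy => rw [inner_smul_left, hy, mul_zero]
  rw [hπ.nondegenerate, Submodule.top_orthogonal_eq_bot, Submodule.mem_bot] at h1
  exact h1

variable [SigmaStarAlgebra C] {b b' : ℕ → C} {a a' : C}

lemma sigmaTendsto_of_tendsto (h : Tendsto b atTop (𝓝 a)) : sigmaTendsto b a := by
  obtain ⟨H, _, _, _, π, hπ⟩ := exists_rep (A := C)
  rw [hπ.conv_iff]
  apply wotTendsto_of_tendsto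
  have hc : Continuous π := (AddMonoidHomClass.isometry_of_norm π hπ.norm_map).continuous
  exact (hc.tendsto a).comp h

lemma sigmaTendsto_const (a : C) : sigmaTendsto (fun _ => a) a :=
  sigmaTendsto_of_tendsto tendsto_const_nhds

lemma sigmaTendsto_bounded (h : sigmaTendsto b a) : ∃ M, ∀ n, ‖b n‖ ≤ M := by
  obtain ⟨H, _, _, _, π, hπ⟩ := exists_rep (A := C)
  obtain ⟨M, hM⟩ := ((hπ.conv_iff _ _).1 h).bounded
  exact ⟨M, fun n => by rw [← hπ.norm_map]; exact hM n⟩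

lemma sigmaTendsto_add (h : sigmaTendsto b a) (h' : sigmaTendsto b' a') :
    sigmaTendsto (fun n => b n + b' n) (a + a') := by
  obtain ⟨H, _, _, _, π, hπ⟩ := exists_rep (A := C)
  rw [hπ.conv_iff, wotTendsto_iff] at *
  intro x y
  simpa [inner_add_right] using (h x y).add (h' x y)

lemma sigmaTendsto_smul (c : ℂ) (h : sigmaTendsto b a) : sigmaTendsto (fun n => c • b n) (c • a) := by
  obtain ⟨H, _, _, _, π, hπ⟩ := exists_rep (A := C)
  rw [hπ.conv_iff, wotTendsto_iff] at *
  intro x y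
  simpa [inner_smul_right] using (h x y).const_mul c

lemma sigmaTendsto_star (h : sigmaTendsto b a) : sigmaTendsto (fun n => star (b n)) (star a) := by
  obtain ⟨H, _, _, _, π, hπ⟩ := exists_rep (A := C)
  rw [hπ.conv_iff] at *
  simpa only [map_star] using h.star

lemma sigmaTendsto_mul_right (h : sigmaTendsto b a) (e : C) :
    sigmaTendsto (fun n => b n * e) (a * e) := by
  obtain ⟨H, _, _, _, π, hπ⟩ := exists_rep (A := C)
  rw [hπ.conv_iff, wotTendsto_iff] at *
  intro x y
  simpa using h (π e x) y

lemma sigmaTendsto_mul_left (h : sigmaTendsto b a) (e : C) :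
    sigmaTendsto (fun n => e * b n) (e * a) := by
  simpa using sigmaTendsto_star (sigmaTendsto_mul_right (sigmaTendsto_star h) (star e))

/-- On a vector π(e)ζ the multiplier moves from the sequence to the vector, because (cq)e = c(qe).
Such vectors are total by nondegeneracy, and the sequence is bounded. -/
lemma sigmaTendsto_snd (q : 𝓜(ℂ, C)) (h : sigmaTendsto b a) :
    sigmaTendsto (fun n => q.snd (b n)) (q.snd a) := by
  obtain ⟨M, hM⟩ := sigmaTendsto_bounded h
  obtain ⟨H, _, _, _, π, hπ⟩ := exists_rep (A := C)
  rw [hπ.conv_iff, wotTendsto_iff] at h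
  rw [hπ.conv_iff]
  refine wotTendsto_of_total (M := ‖q.snd‖ * M) (fun n => ?_) hπ.nondegenerate
    topologicalClosure_span_univ ?_
  · rw [hπ.norm_map]
    exact (q.snd.le_opNorm _).trans (by gcongr; exact hM n)
  · rintro x ⟨e, ζ, rfl⟩ y -
    have e1 : ∀ c, π (q.snd c) (π e ζ) = π c (π (q.fst e) ζ) := fun c => by
      have := congrArg (fun d => π d ζ) (q.central c e)
      simpa using this
    simp only [e1]
    exact h _ _

lemma sigmaTendsto_fst (q : 𝓜(ℂ, C)) (h : sigmaTendsto b a) :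
    sigmaTendsto (fun n => q.fst (b n)) (q.fst a) := by
  simpa [DoubleCentralizer.star_snd] using
    sigmaTendsto_star (sigmaTendsto_snd (star q) (sigmaTendsto_star h))

lemma subset_sigmaClosure (S : Set C) : S ⊆ sigmaClosure S :=
  Set.subset_sInter fun _ hT => hT.2

lemma IsSigmaDense.eq_univ {S T : Set C} (hS : IsSigmaDense S) (hT : IsSigmaClosed T)
    (h : S ⊆ T) : T = Set.univ :=
  Set.eq_univ_of_univ_subset (hS ▸ Set.sInter_subset_of_mem ⟨hT, h⟩)

lemma isSigmaClosed_sigmaClosure (S : Set C) : IsSigmaClosed (sigmaClosure S) :=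
  fun b a hb h => Set.mem_sInter.2 fun T hT => hT.1 b a (fun n => Set.mem_sInter.1 (hb n) T hT) h

lemma IsSigmaClosed.isClosed {T : Set C} (hT : IsSigmaClosed T) : IsClosed T := by
  rw [← isSeqClosed_iff_isClosed]
  exact fun b a hb h => hT b a hb (sigmaTendsto_of_tendsto h)

/-- A bounded sequence `a` is σ-convergent as soon as `a * w` is σ-convergent for enough `w`. -/
lemma exists_sigmaTendsto_of_mul {u : ℕ → C} {M : ℝ} (hM : ∀ n, ‖u n‖ ≤ M)
    (h : ∀ n, u n ∈ sigmaClosure {d | ∃ l, sigmaTendsto (fun m => u m * star d) l}) :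
    ∃ l, sigmaTendsto u l := by
  obtain ⟨H, _, _, _, π, hπ⟩ := exists_rep (A := C)
  let D : Set H := {η | ∃ w ζ, (∃ l, sigmaTendsto (fun m => u m * w) l) ∧ η = π w ζ}
  let K := (Submodule.span ℂ D).topologicalClosure
  have : CompleteSpace K := (Submodule.isClosed_topologicalClosure _).completeSpace_coe
  -- If (u_m d*) converges, then π(d*)H lies in K, so π(d) kills `ξ`. Killing `ξ` is a σ-closed
  -- condition and therefore reaches every u_n.
  have hperp : ∀ ξ ∈ Kᗮ, ∀ n, π (u n) ξ = 0 := by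
    intro ξ hξ n
    refine Set.mem_sInter.1 (h n) {c | π c ξ = 0} ⟨?_, ?_⟩
    · intro b a hb hba
      rw [hπ.conv_iff, wotTendsto_iff] at hba
      refine ext_inner_left ℂ fun y => tendsto_nhds_unique (hba ξ y) ?_
      have : ∀ n, π (b n) ξ = 0 := hb
      simp [this]
    · rintro d ⟨l, hl⟩
      refine ext_inner_left ℂ fun y => ?_
      rw [inner_zero_right, ← inner_rep_left]
      exact (Submodule.mem_orthogonal _ _).1 hξ _ (Submodule.le_topologicalClosure _
        (Submodule.subset_span ⟨star d, y, ⟨l, hl⟩, rfl⟩))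
  -- The coefficients converge on `D` by its definition and vanish on `Kᗮ`; together these two sets
  -- are total.
  obtain ⟨S, hS⟩ := exists_wotTendsto_of_cauchySeq (T := fun n => π (u n)) (M := M)
    (fun n => by rw [hπ.norm_map]; exact hM n) (D := D ∪ Kᗮ) (D' := Set.univ) (by
      rw [eq_top_iff]
      intro x _
      have h1 : K ≤ (Submodule.span ℂ (D ∪ Kᗮ)).topologicalClosure :=
        Submodule.topologicalClosure_mono (Submodule.span_mono Set.subset_union_left)
      have h2 : Kᗮ ≤ (Submodule.span ℂ (D ∪ Kᗮ)).topologicalClosure := fun y hy =>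
        Submodule.le_topologicalClosure _ (Submodule.subset_span (Or.inr hy))
      have h3 := add_mem (h1 (K.starProjection_apply_mem x))
        (h2 (K.sub_starProjection_mem_orthogonal x))
      rwa [add_sub_cancel] at h3)
    topologicalClosure_span_univ (by
      rintro x (⟨w, ζ, ⟨l, hl⟩, rfl⟩ | hx) y -
      · rw [hπ.conv_iff, wotTendsto_iff] at hl
        simpa using (hl ζ y).cauchySeq
      · simpa [hperp x hx] using cauchySeq_const (0 : ℂ))
  obtain ⟨l, hl⟩ := hπ.range_closed _ _ hS
  exact ⟨l, (hπ.conv_iff _ _).2 (hl ▸ hS)⟩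

end Calculus

/-! ### Complementary corners give imprimitivity bimodules -/

section CornerBimodule

variable {C : Type u} [NonUnitalCStarAlgebra C] [SigmaStarAlgebra C] {p q : 𝓜(ℂ, C)}

lemma isSigmaClosed_cornerSpace (hp : IsStarProjection p) (hq : IsStarProjection q) :
    IsSigmaClosed (cornerSpace p q : Set C) := by
  intro b a hb h
  have e : ∀ n, p.fst (b n) = b n ∧ q.snd (b n) = b n := fun n => (mem_cornerSpace hp hq).1 (hb n)
  have h1 := sigmaTendsto_fst p h
  have h2 := sigmaTendsto_snd q h
  simp only [e] at h1 h2
  exact (mem_cornerSpace hp hq).2 ⟨sigmaTendsto_unique h1 h, sigmaTendsto_unique h2 h⟩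

/-- If `CpC` is σ-dense, a sequence `u` in `pCq` is σ-convergent as soon as `u * y*` is
σ-convergent for all `y` in `pCq`. -/
lemma exists_sigmaTendsto_cornerSpace (hp : IsStarProjection p) (hq : IsStarProjection q)
    (hd : IsSigmaDense (cornerIdeal p : Set C)) {u : ℕ → C} (hu : ∀ n, u n ∈ cornerSpace p q)
    (h : ∀ y ∈ cornerSpace p q, ∃ l, sigmaTendsto (fun n => u n * star y) l) :
    ∃ x ∈ cornerSpace p q, sigmaTendsto u x := by
  -- Left multiplications by u_n on qCp are pointwise bounded, hence uniformly bounded by some M.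
  -- Evaluation at u_n* gives ‖u_n‖² ≤ M‖u_n‖.
  obtain ⟨M, hM⟩ : ∃ M, ∀ n, ‖u n‖ ≤ M := by
    have : CompleteSpace (cornerSpace q p) := (isClosed_cornerSpace hq hp).completeSpace_coe
    obtain ⟨M, hM⟩ := banach_steinhaus
      (g := fun n => (ContinuousLinearMap.mul ℂ C (u n)).comp (cornerSpace q p).subtypeL)
      fun w => by
        obtain ⟨l, hl⟩ := h _ (star_mem_cornerSpace hq hp w.2)
        obtain ⟨M, hM⟩ := sigmaTendsto_bounded hl
        exact ⟨M, fun n => by simpa using hM n⟩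
    refine ⟨M, fun n => ?_⟩
    have h1 := ((ContinuousLinearMap.mul ℂ C (u n)).comp (cornerSpace q p).subtypeL).le_of_opNorm_le
      (hM n) ⟨star (u n), star_mem_cornerSpace hp hq (hu n)⟩
    have h2 : ‖u n‖ * ‖u n‖ ≤ M * ‖u n‖ := by
      rw [← CStarRing.norm_self_mul_star]
      simpa using h1
    rcases (norm_nonneg (u n)).eq_or_lt with h0 | h0
    · rw [← h0]; exact (norm_nonneg _).trans (hM 0)
    · exact le_of_mul_le_mul_right h2 h0
  let I : Set C := {d | ∃ l, sigmaTendsto (fun m => u m * star d) l}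
  -- Since u_m (c p d q)* = u_m (p d q)* c* with pdq in pCq, right multiplication by q sends CpC
  -- into `I`. By density it sends C into the σ-closure of `I`, and u_n = u_n q.
  have hI : {c | q.snd c ∈ sigmaClosure I} = Set.univ := by
    refine hd.eq_univ (fun b a hb hba => isSigmaClosed_sigmaClosure I _ _ hb
      (sigmaTendsto_snd q hba)) fun c hc => subset_sigmaClosure I ?_
    induction hc using Submodule.span_induction with
    | mem c hc =>
      obtain ⟨c, d, rfl⟩ := hc
      obtain ⟨l, hl⟩ := h (q.snd (p.fst d)) ((mem_cornerSpace hp hq).2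
        ⟨by rw [fst_snd_comm, fst_fst hp], snd_snd hq _⟩)
      refine ⟨l * star c, ?_⟩
      rw [snd_mul, star_mul]
      simpa only [mul_assoc] using sigmaTendsto_mul_right hl (star c)
    | zero => exact ⟨0, by simpa using sigmaTendsto_const (0 : C)⟩
    | add c d _ _ hc hd =>
      obtain ⟨l, hl⟩ := hc
      obtain ⟨l', hl'⟩ := hd
      exact ⟨l + l', by simpa [mul_add] using sigmaTendsto_add hl hl'⟩
    | smul z c _ hc =>
      obtain ⟨l, hl⟩ := hc
      exact ⟨star z • l, by simpa [mul_smul_comm] using sigmaTendsto_smul (star z) hl⟩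
  obtain ⟨x, hx⟩ := exists_sigmaTendsto_of_mul hM fun n => by
    have : u n ∈ {c | q.snd c ∈ sigmaClosure I} := hI ▸ Set.mem_univ _
    rwa [Set.mem_ofPred_eq, ((mem_cornerSpace hp hq).1 (hu n)).2] at this
  exact ⟨x, isSigmaClosed_cornerSpace hp hq u x hu hx, hx⟩

/-- Module convergence already forces a σ-limit x' in C, and uniqueness of limits gives (x − x')(x −
x')* = 0. -/
lemma leftCornerModule_modTendsto_iff (hp : IsStarProjection p) (hq : IsStarProjection q)
    (hd : IsSigmaDense (cornerIdeal p : Set C)) {u : ℕ → cornerSpace p q} {x : cornerSpace p q} :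
    (leftCornerModule hp hq).ModTendsto u x ↔ sigmaTendsto (fun n => (u n : C)) (x : C) := by
  constructor
  · intro h
    obtain ⟨x', hx', hux⟩ := exists_sigmaTendsto_cornerSpace hp hq hd (fun n => (u n).2)
      fun y hy => ⟨_, h ⟨y, hy⟩⟩
    have h1 : ((x : C) - x') * star ((x : C) - x') = 0 := by
      rw [sub_mul, sub_eq_zero]
      exact sigmaTendsto_unique (h ⟨_, sub_mem x.2 hx'⟩) (sigmaTendsto_mul_right hux _)
    rw [CStarRing.mul_star_self_eq_zero_iff, sub_eq_zero] at h1
    rwa [h1]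
  · exact fun h y => sigmaTendsto_mul_right h _

/-- The adjoint carries pCq with the inner product x*y to qCp with xy*, so this is the left case
with the projections exchanged. -/
lemma rightCornerModule_modTendsto_iff (hp : IsStarProjection p) (hq : IsStarProjection q)
    (hd : IsSigmaDense (cornerIdeal q : Set C)) {u : ℕ → cornerSpace p q} {x : cornerSpace p q} :
    (rightCornerModule hp hq).ModTendsto u x ↔ sigmaTendsto (fun n => (u n : C)) (x : C) := by
  let s : cornerSpace p q → cornerSpace q p := fun y => ⟨star y, star_mem_cornerSpace hp hq y.2⟩
  rw [show sigmaTendsto (fun n => (u n : C)) (x : C) ↔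
      sigmaTendsto (fun n => (s (u n) : C)) (s x : C) from ⟨sigmaTendsto_star, fun h => by
        simpa [s] using sigmaTendsto_star h⟩, ← leftCornerModule_modTendsto_iff hq hp hd]
  constructor
  · intro h y
    have h1 := h ⟨star y, star_mem_cornerSpace hq hp y.2⟩
    exact h1
  · intro h y
    have h1 := h ⟨star y, star_mem_cornerSpace hp hq y.2⟩
    change sigmaTendsto (fun n => star (u n : C) * star (star (y : C)))
      (star (x : C) * star (star (y : C))) at h1
    rw [star_star] at h1
    exact h1

lemma isSigmaModule_leftCornerModule (hp : IsStarProjection p) (hq : IsStarProjection q)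
    (hd : IsSigmaDense (cornerIdeal p : Set C)) : (leftCornerModule hp hq).IsSigmaModule := by
  intro u h
  obtain ⟨x, hx, hux⟩ := exists_sigmaTendsto_cornerSpace hp hq hd (fun n => (u n).2)
    fun y hy => by
      obtain ⟨a, ha⟩ := h ⟨y, hy⟩
      exact ⟨a, ha⟩
  exact ⟨⟨x, hx⟩, (leftCornerModule_modTendsto_iff hp hq hd).2 hux⟩

lemma isSigmaModule_rightCornerModule (hp : IsStarProjection p) (hq : IsStarProjection q)
    (hd : IsSigmaDense (cornerIdeal q : Set C)) : (rightCornerModule hp hq).IsSigmaModule := by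
  intro u h
  obtain ⟨x, hx, hux⟩ := exists_sigmaTendsto_cornerSpace hq hp hd
    (fun n => star_mem_cornerSpace hp hq (u n).2) fun y hy => by
      obtain ⟨a, ha⟩ := h ⟨star y, star_mem_cornerSpace hq hp hy⟩
      exact ⟨a, ha⟩
  refine ⟨⟨star x, star_mem_cornerSpace hq hp hx⟩,
    (rightCornerModule_modTendsto_iff hp hq hd).2 ?_⟩
  simpa using sigmaTendsto_star hux

/-- The compression c ↦ pcp is σ-continuous, fixes pCp and sends cqd to (pcq)(qdp), which has the
form xy*. Density of CqC thus descends to pCp. The set `S` is kept abstract so that left and right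
inner products are both covered. -/
lemma isSigmaDense_span_inner (hp : IsStarProjection p) (hq : IsStarProjection q)
    (hd : IsSigmaDense (cornerIdeal q : Set C)) {S : Set (corner p hp)}
    (hS : ∀ (x y : cornerSpace p q) (a : corner p hp), (a : C) = x * star (y : C) → a ∈ S) :
    IsSigmaDense (Submodule.span ℂ S : Set (corner p hp)) := by
  let cut : C → corner p hp := fun c => ⟨p.fst (p.snd c), ⟨c, rfl⟩⟩
  refine Set.eq_univ_of_forall fun a => Set.mem_sInter.2 ?_
  rintro T ⟨hT, hST⟩
  have h1 : {c | cut c ∈ T} = Set.univ := by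
    refine hd.eq_univ (fun b a hb hba => hT _ _ hb
      (sigmaTendsto_fst p (sigmaTendsto_snd p hba))) fun c hc => hST ?_
    induction hc using Submodule.span_induction with
    | mem c hc =>
      obtain ⟨c, d, rfl⟩ := hc
      refine Submodule.subset_span (hS ⟨p.fst (q.snd c), ⟨c, rfl⟩⟩
        ⟨star (q.fst (p.snd d)), star_mem_cornerSpace hq hp ⟨d, rfl⟩⟩ _ ?_)
      change p.fst (p.snd (c * q.fst d)) = p.fst (q.snd c) * star (star (q.fst (p.snd d)))
      rw [star_star, snd_mul, ← fst_snd_comm q p, fst_mul, fst_snd_comm p q, q.central, fst_fst hq]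
    | zero =>
      have e : cut 0 = 0 := Subtype.ext (by change p.fst (p.snd 0) = 0; simp)
      rw [e]
      exact zero_mem (Submodule.span ℂ S)
    | add c d _ _ hc hd =>
      have e : cut (c + d) = cut c + cut d := Subtype.ext (by
        change p.fst (p.snd (c + d)) = p.fst (p.snd c) + p.fst (p.snd d); simp)
      rw [e]
      exact add_mem (S := Submodule ℂ (corner p hp)) hc hd
    | smul z c _ hc =>
      have e : cut (z • c) = z • cut c := Subtype.ext (by
        change p.fst (p.snd (z • c)) = z • p.fst (p.snd c); simp)
      rw [e]
      exact Submodule.smul_mem _ z hc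
  have h2 : (a : C) ∈ {c | cut c ∈ T} := h1 ▸ Set.mem_univ (a : C)
  change cut a ∈ T at h2
  convert h2
  obtain ⟨e1, e2⟩ := (mem_cornerSpace hp hp).1 a.2
  exact Subtype.ext (by change _ = p.fst (p.snd a); rw [e2, e1])

lemma isImprimitivityBimodule_corner (hp : IsStarProjection p) (hq : IsStarProjection q)
    (hdp : IsSigmaDense (cornerIdeal p : Set C)) (hdq : IsSigmaDense (cornerIdeal q : Set C)) :
    IsImprimitivityBimodule (leftCornerModule hp hq) (rightCornerModule hp hq) where
  act_assoc a x b := Subtype.ext (mul_assoc _ _ _)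
  left_isSigmaModule := isSigmaModule_leftCornerModule hp hq hdp
  left_isSigmaFull := isSigmaDense_span_inner hp hq hdq fun x y a h => ⟨x, y, Subtype.ext h⟩
  right_isSigmaModule := isSigmaModule_rightCornerModule hp hq hdq
  right_isSigmaFull := isSigmaDense_span_inner hq hp hdp fun x y a h =>
    ⟨⟨star x, star_mem_cornerSpace hq hp x.2⟩, ⟨star y, star_mem_cornerSpace hq hp y.2⟩,
      Subtype.ext (by
        rw [h]
        change _ = star (star (x : C)) * star (y : C)
        rw [star_star])⟩
  inner_act_eq x y z := Subtype.ext (mul_assoc _ _ _)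
  modTendsto_iff u x := (leftCornerModule_modTendsto_iff hp hq hdp).trans
    (rightCornerModule_modTendsto_iff hp hq hdq).symm

end CornerBimodule

/-! ### Transport of imprimitivity bimodules along Σ*-isomorphisms -/

section Transport

lemma norm_starAlgEquiv {A A' : Type*} [NonUnitalCStarAlgebra A]
    [NonUnitalCStarAlgebra A'] (φ : A ≃⋆ₐ[ℂ] A') (a : A) : ‖φ a‖ = ‖a‖ :=
  NonUnitalStarAlgHom.norm_map φ φ.injective a

variable {A A' B B' X : Type*} [NonUnitalCStarAlgebra A] [SigmaStarAlgebra A]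
  [NonUnitalCStarAlgebra A'] [SigmaStarAlgebra A'] [NonUnitalCStarAlgebra B] [SigmaStarAlgebra B]
  [NonUnitalCStarAlgebra B'] [SigmaStarAlgebra B'] [AddCommGroup X] [Module ℂ X]

/-- Change of the scalars of a left C*-module along a *-isomorphism. -/
def LeftCStarModule.transport (L : LeftCStarModule A' X) (φ : A ≃⋆ₐ[ℂ] A') :
    LeftCStarModule A X where
  act := LinearMap.mk₂ ℂ (fun a x => L.act (φ a) x) (fun a b x => by simp)
    (fun c a x => by simp) (fun a x y => by simp) (fun c a x => by simp)
  inner := LinearMap.mk₂'ₛₗ (RingHom.id ℂ) (starRingEnd ℂ) (fun x y => φ.symm (L.inner x y))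
    (fun x y z => by simp) (fun c x y => by simp) (fun x y z => by simp) (fun c x y => by simp)
  mul_act a b x := by simp [L.mul_act]
  inner_act a x y := by simp [L.inner_act]
  star_inner x y := by simp [← map_star, L.star_inner]
  inner_self_nonneg x := by
    obtain ⟨a, ha⟩ := L.inner_self_nonneg x
    exact ⟨φ.symm a, by simp [ha, map_star]⟩
  inner_self_eq_zero x h := L.inner_self_eq_zero x (by simpa using h)
  complete u hu := by
    change ∀ ε > 0, ∃ N, ∀ m ≥ N, ∀ n ≥ N, √‖φ.symm (L.inner (u m - u n) (u m - u n))‖ < ε at hu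
    change ∃ x, Tendsto (fun n => √‖φ.symm (L.inner (u n - x) (u n - x))‖) atTop (𝓝 0)
    simp only [norm_starAlgEquiv] at hu ⊢
    exact L.complete u hu

/-- Change of the scalars of a right C*-module along a *-isomorphism. -/
def RightCStarModule.transport (R : RightCStarModule B' X) (ψ : B ≃⋆ₐ[ℂ] B') :
    RightCStarModule B X where
  act := LinearMap.mk₂ ℂ (fun x b => R.act x (ψ b)) (fun a b x => by simp)
    (fun c a x => by simp) (fun a x y => by simp) (fun c a x => by simp)
  inner := LinearMap.mk₂'ₛₗ (starRingEnd ℂ) (RingHom.id ℂ) (fun x y => ψ.symm (R.inner x y))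
    (fun x y z => by simp) (fun c x y => by simp) (fun x y z => by simp) (fun c x y => by simp)
  act_mul x a b := by simp [R.act_mul]
  inner_act x y b := by simp [R.inner_act]
  star_inner x y := by simp [← map_star, R.star_inner]
  inner_self_nonneg x := by
    obtain ⟨a, ha⟩ := R.inner_self_nonneg x
    exact ⟨ψ.symm a, by simp [ha, map_star]⟩
  inner_self_eq_zero x h := R.inner_self_eq_zero x (by simpa using h)
  complete u hu := by
    change ∀ ε > 0, ∃ N, ∀ m ≥ N, ∀ n ≥ N, √‖ψ.symm (R.inner (u m - u n) (u m - u n))‖ < ε at hu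
    change ∃ x, Tendsto (fun n => √‖ψ.symm (R.inner (u n - x) (u n - x))‖) atTop (𝓝 0)
    simp only [norm_starAlgEquiv] at hu ⊢
    exact R.complete u hu

lemma sigmaTendsto_symm_iff {φ : A ≃⋆ₐ[ℂ] A'} (hφ : SigmaContinuous φ)
    (hφ' : SigmaContinuous φ.symm) {b : ℕ → A'} {a : A'} :
    sigmaTendsto (fun n => φ.symm (b n)) (φ.symm a) ↔ sigmaTendsto b a :=
  ⟨fun h => by simpa using hφ _ _ h, fun h => hφ' _ _ h⟩

lemma isSigmaDense_span_image {φ : A ≃⋆ₐ[ℂ] A'} (hφ' : SigmaContinuous φ.symm) {S : Set A}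
    {S' : Set A'} (hS' : IsSigmaDense (Submodule.span ℂ S' : Set A')) (h : ∀ a ∈ S', φ.symm a ∈ S) :
    IsSigmaDense (Submodule.span ℂ S : Set A) := by
  refine Set.eq_univ_of_forall fun a => Set.mem_sInter.2 ?_
  rintro T ⟨hT, hST⟩
  have h1 : ⋂₀ {T | IsSigmaClosed T ∧ (Submodule.span ℂ S' : Set A') ⊆ T} ⊆ φ.symm ⁻¹' T :=
    Set.sInter_subset_of_mem ⟨fun b a hb hba => hT _ _ hb (hφ' _ _ hba), fun c hc => hST (by
      induction hc using Submodule.span_induction with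
      | mem c hc => exact Submodule.subset_span (h c hc)
      | zero => simp
      | add c d _ _ hc hd => simpa using add_mem hc hd
      | smul z c _ hc => simpa using Submodule.smul_mem _ z hc)⟩
  have h2 : φ a ∈ φ.symm ⁻¹' T := h1 (by
    have : φ a ∈ sigmaClosure (Submodule.span ℂ S' : Set A') := hS' ▸ Set.mem_univ _
    exact this)
  simpa using h2

lemma IsImprimitivityBimodule.transport {L : LeftCStarModule A' X} {R : RightCStarModule B' X}
    (h : IsImprimitivityBimodule L R) {φ : A ≃⋆ₐ[ℂ] A'} (hφ : SigmaContinuous φ)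
    (hφ' : SigmaContinuous φ.symm) {ψ : B ≃⋆ₐ[ℂ] B'} (hψ : SigmaContinuous ψ)
    (hψ' : SigmaContinuous ψ.symm) :
    IsImprimitivityBimodule (L.transport φ) (R.transport ψ) where
  act_assoc a x b := h.act_assoc _ _ _
  left_isSigmaModule u hu := by
    obtain ⟨x, hx⟩ := h.left_isSigmaModule u fun y => by
      obtain ⟨a, ha⟩ := hu y
      rw [← φ.symm_apply_apply a] at ha
      exact ⟨φ a, (sigmaTendsto_symm_iff hφ hφ').1 ha⟩
    exact ⟨x, fun y => hφ' _ _ (hx y)⟩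
  left_isSigmaFull := isSigmaDense_span_image hφ' h.left_isSigmaFull (by
    rintro _ ⟨x, y, rfl⟩
    exact ⟨x, y, rfl⟩)
  right_isSigmaModule u hu := by
    obtain ⟨x, hx⟩ := h.right_isSigmaModule u fun y => by
      obtain ⟨a, ha⟩ := hu y
      rw [← ψ.symm_apply_apply a] at ha
      exact ⟨ψ a, (sigmaTendsto_symm_iff hψ hψ').1 ha⟩
    exact ⟨x, fun y => hψ' _ _ (hx y)⟩
  right_isSigmaFull := isSigmaDense_span_image hψ' h.right_isSigmaFull (by
    rintro _ ⟨x, y, rfl⟩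
    exact ⟨x, y, rfl⟩)
  inner_act_eq x y z := by
    change L.act (φ (φ.symm (L.inner x y))) z = R.act x (ψ (ψ.symm (R.inner y z)))
    simpa using h.inner_act_eq x y z
  modTendsto_iff u x := by
    have h1 : (L.transport φ).ModTendsto u x ↔ L.ModTendsto u x :=
      forall_congr' fun y => sigmaTendsto_symm_iff hφ hφ'
    have h2 : (R.transport ψ).ModTendsto u x ↔ R.ModTendsto u x :=
      forall_congr' fun y => sigmaTendsto_symm_iff hψ hψ'
    rw [h1, h2, h.modTendsto_iff]

end Transport

/-! ### Algebra of imprimitivity bimodules -/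

section Algebra

variable {A B X : Type*} [NonUnitalCStarAlgebra A] [SigmaStarAlgebra A]
  [NonUnitalCStarAlgebra B] [SigmaStarAlgebra B] [AddCommGroup X] [Module ℂ X]
  {L : LeftCStarModule A X} {R : RightCStarModule B X}

/-- The set of d with ad = 0 is σ-closed and contains the inner products, as a⟨x|y⟩ = ⟨ax|y⟩. By
fullness it contains a*, so aa* = 0. -/
lemma LeftCStarModule.IsSigmaFull.eq_zero_of_act (hL : L.IsSigmaFull) {a : A}
    (h : ∀ x, L.act a x = 0) : a = 0 := by
  have h1 : {d : A | a * d = 0} = Set.univ := by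
    refine hL.eq_univ (fun b c hb hbc => ?_) fun c hc => ?_
    · have h2 := sigmaTendsto_mul_left hbc a
      have hb' : ∀ n, a * b n = 0 := hb
      simp only [hb'] at h2
      exact sigmaTendsto_unique h2 (sigmaTendsto_const 0)
    · change a * c = 0
      induction hc using Submodule.span_induction with
      | mem c hc =>
        obtain ⟨x, y, rfl⟩ := hc
        rw [← L.inner_act, h, map_zero, LinearMap.zero_apply]
      | zero => simp
      | add c d _ _ hc hd => rw [mul_add, hc, hd, add_zero]
      | smul z c _ hc => rw [mul_smul_comm, hc, smul_zero]
  have h2 : star a ∈ {d : A | a * d = 0} := h1 ▸ Set.mem_univ _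
  exact (CStarRing.mul_star_self_eq_zero_iff a).1 h2

lemma RightCStarModule.IsSigmaFull.eq_zero_of_act (hR : R.IsSigmaFull) {b : B}
    (h : ∀ x, R.act x b = 0) : b = 0 := by
  have h1 : {d : B | d * b = 0} = Set.univ := by
    refine hR.eq_univ (fun b' c hb hbc => ?_) fun c hc => ?_
    · have h2 := sigmaTendsto_mul_right hbc b
      have hb' : ∀ n, b' n * b = 0 := hb
      simp only [hb'] at h2
      exact sigmaTendsto_unique h2 (sigmaTendsto_const 0)
    · change c * b = 0
      induction hc using Submodule.span_induction with
      | mem c hc =>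
        obtain ⟨x, y, rfl⟩ := hc
        rw [← R.inner_act, h, map_zero]
      | zero => simp
      | add c d _ _ hc hd => rw [add_mul, hc, hd, add_zero]
      | smul z c _ hc => rw [smul_mul_assoc, hc, smul_zero]
  have h2 : star b ∈ {d : B | d * b = 0} := h1 ▸ Set.mem_univ _
  exact (CStarRing.star_mul_self_eq_zero_iff b).1 h2

/-- The left action of an imprimitivity bimodule is by adjointable operators of the right module. -/
lemma IsImprimitivityBimodule.inner_act_left (h : IsImprimitivityBimodule L R) (a : A) (x y : X) :
    R.inner (L.act a x) y = R.inner x (L.act (star a) y) := by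
  rw [← sub_eq_zero]
  -- The computation is z⟨ax|y⟩ = ⟨z|ax⟩y = ⟨z|x⟩a*y = z⟨x|a*y⟩, with A-valued inner products in the
  -- middle terms.
  refine h.right_isSigmaFull.eq_zero_of_act fun z => ?_
  rw [map_sub, sub_eq_zero, ← h.inner_act_eq, ← h.inner_act_eq, ← L.mul_act, ← L.star_inner,
    L.inner_act, star_mul, L.star_inner]

end Algebra

/-- In a C*-algebra, `1 - a* a` is the square of a self-adjoint element `1 - c` of the
unitization if `a` is a contraction. -/
lemma exists_isSelfAdjoint_mul_self_eq {A : Type*} [NonUnitalCStarAlgebra A] {a : A}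
    (ha : ‖a‖ ≤ 1) : ∃ c : A, star c = c ∧ c * c = c + c - star a * a := by
  -- This function solves f² = 2f − t for t ≤ 1, which covers the spectrum of a*a. It vanishes at 0,
  -- as the non-unital calculus requires.
  let f : ℝ → ℝ := fun t => 1 - √(1 - t)
  have hf : Continuous f := by fun_prop
  have hf0 : f 0 = 0 := by simp [f]
  have hsa : IsSelfAdjoint (star a * a) := IsSelfAdjoint.star_mul_self a
  refine ⟨cfcₙ f (star a * a), (cfcₙ_predicate f (star a * a) : IsSelfAdjoint _).star_eq, ?_⟩
  rw [← cfcₙ_mul f f _ hf.continuousOn hf0 hf.continuousOn hf0,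
    ← cfcₙ_add f f _ hf.continuousOn hf0 hf.continuousOn hf0]
  have e : cfcₙ (fun t => f t + f t) (star a * a) - star a * a =
      cfcₙ (fun t => f t + f t - t) (star a * a) := by
    rw [cfcₙ_sub (fun t => f t + f t) (fun t => t) _ (by fun_prop) (by simp [hf0])
      (by fun_prop) rfl, cfcₙ_id' ℝ (star a * a)]
  rw [e]
  refine cfcₙ_congr fun t ht => ?_
  have ht1 : t ≤ 1 := by
    have h1 := NonUnitalIsometricContinuousFunctionalCalculus.norm_quasispectrum_le _ ht hsa
    rw [CStarRing.norm_star_mul_self] at h1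
    nlinarith [Real.le_norm_self t, norm_nonneg a]
  have h2 := Real.mul_self_sqrt (sub_nonneg.2 ht1)
  simp only [f]
  linarith

/-! ### The interior tensor product of a right C*-module with a representation -/

section Tensor

variable {B : Type u} {X : Type u} [NonUnitalCStarAlgebra B] [AddCommGroup X] [Module ℂ X]
  {V : Type u} [NormedAddCommGroup V] [InnerProductSpace ℂ V] [CompleteSpace V]
  {conv : (ℕ → B) → B → Prop} {ρ : B →⋆ₙₐ[ℂ] (V →L[ℂ] V)}

lemma RightCStarModule.inner_act_left (R : RightCStarModule B X) (x y : X) (b : B) :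
    R.inner (R.act x b) y = star b * R.inner x y := by
  rw [← R.star_inner, R.inner_act, star_mul, R.star_inner]

/-- Positivity of Gram matrices on vectors in the closure of a cyclic subspace. -/
lemma gram_nonneg_of_cyclic (R : RightCStarModule B X) (κ : V) (s : Finset X)
    (k : X → V) (hk : ∀ x, k x ∈ closure (Set.range fun b => ρ b κ)) :
    0 ≤ RCLike.re (∑ x ∈ s, ∑ y ∈ s, inner ℂ (ρ (R.inner y x) (k x)) (k y)) := by
  let F : (X → V) → ℝ := fun k =>
    RCLike.re (∑ x ∈ s, ∑ y ∈ s, inner ℂ (ρ (R.inner y x) (k x)) (k y))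
  have hF : Continuous F := by
    refine RCLike.continuous_re.comp ?_
    refine continuous_finsetSum _ fun x _ => continuous_finsetSum _ fun y _ => ?_
    exact ((ρ (R.inner y x)).continuous.comp (continuous_apply x)).inner (continuous_apply y)
  have hcl : IsClosed {k | 0 ≤ F k} := isClosed_le continuous_const hF
  have hsub : Set.pi Set.univ (fun _ : X => Set.range fun b => ρ b κ) ⊆ {k | 0 ≤ F k} := by
    intro k hk
    choose β hβ using fun x => hk x (Set.mem_univ x)
    -- For k x = ρ(β x)κ the Gram sum collapses to ⟨ρ(⟨ξ|ξ⟩)κ|κ⟩ with ξ = ∑ x β_x, and this is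
    -- ‖ρ(c)κ‖².
    obtain ⟨c, hc⟩ := R.inner_self_nonneg (∑ x ∈ s, R.act x (β x))
    have e : ∑ x ∈ s, ∑ y ∈ s, inner ℂ (ρ (R.inner y x) (k x)) (k y) = inner ℂ (ρ c κ) (ρ c κ) := by
      have h1 : ∀ x y, inner ℂ (ρ (R.inner y x) (k x)) (k y) =
          inner ℂ (ρ (R.inner (R.act y (β y)) (R.act x (β x))) κ) κ := fun x y => by
        rw [R.inner_act, R.inner_act_left, ← hβ, ← hβ, ← inner_rep_left ρ (β y)]
        simp
      rw [← inner_rep_left ρ c, ← mul_apply_eq_comp, ← map_mul, ← hc]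
      simp only [h1, map_sum, LinearMap.sum_apply, _root_.sum_apply, sum_inner]
    change 0 ≤ RCLike.re _
    rw [e]
    exact inner_self_nonneg
  have := closure_minimal hsub hcl
  rw [closure_pi_set] at this
  exact this fun x _ => hk x

/-- Induction on a finite set carrying `k`. The closed cyclic subspace M generated by k a reduces ρ,
so the Gram sum splits along M and its complement. The part in M is the cyclic case. In the
complement the entry at a vanishes, because nondegeneracy forces k a into M, and the carrying set
shrinks. -/
lemma gram_nonneg (R : RightCStarModule B X) (hρ : IsFaithfulSigmaRep conv ρ)
    (s : Finset X) (k : X → V) :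
    0 ≤ RCLike.re (∑ x ∈ s, ∑ y ∈ s, inner ℂ (ρ (R.inner y x) (k x)) (k y)) := by
  suffices h : ∀ t : Finset X, ∀ k : X → V, (∀ x ∉ t, k x = 0) →
      0 ≤ RCLike.re (∑ x ∈ s, ∑ y ∈ s, inner ℂ (ρ (R.inner y x) (k x)) (k y)) by
    classical
    have h1 := h s (fun x => if x ∈ s then k x else 0) fun x hx => if_neg hx
    rwa [Finset.sum_congr rfl fun x hx => Finset.sum_congr rfl fun y hy => by
      rw [if_pos hx, if_pos hy]] at h1
  classical
  intro t
  induction t using Finset.induction_on with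
  | empty => intro k hk; simp [hk]
  | insert a t hat ih =>
    intro k hk
    let φ : B →ₗ[ℂ] V :=
      { toFun := fun b => ρ b (k a)
        map_add' := fun b c => by simp
        map_smul' := fun z b => by simp }
    let M : Submodule ℂ V := (LinearMap.range φ).topologicalClosure
    have : CompleteSpace M := (Submodule.isClosed_topologicalClosure _).completeSpace_coe
    have hM : ∀ b, ∀ ξ ∈ M, ρ b ξ ∈ M := fun b ξ hξ =>
      map_mem_closure (ρ b).continuous hξ (by
        rintro _ ⟨c, rfl⟩
        exact ⟨b * c, by simp [φ]⟩)
    have hM' : ∀ b, ∀ ξ ∈ Mᗮ, ρ b ξ ∈ Mᗮ := fun b ξ hξ => by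
      rw [Submodule.mem_orthogonal] at hξ ⊢
      intro u hu
      rw [← inner_rep_left]
      exact hξ _ (hM _ u hu)
    have hP : ∀ ξ, M.starProjection ξ ∈ M := M.starProjection_apply_mem
    have hP' : ∀ ξ, ξ - M.starProjection ξ ∈ Mᗮ := M.sub_starProjection_mem_orthogonal
    have hka : k a - M.starProjection (k a) = 0 := by
      refine hρ.eq_zero_of_forall fun b => ?_
      have h1 : ρ b (k a - M.starProjection (k a)) ∈ M := by
        rw [map_sub]
        exact sub_mem (Submodule.le_topologicalClosure _ ⟨b, rfl⟩) (hM b _ (hP _))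
      exact inner_self_eq_zero.1 ((Submodule.mem_orthogonal _ _).1 (hM' b _ (hP' _)) _ h1)
    have h1 := gram_nonneg_of_cyclic (ρ := ρ) R (k a) s (fun x => M.starProjection (k x))
      fun x => hP (k x)
    have h2 := ih (fun x => k x - M.starProjection (k x)) fun x hx => by
      by_cases hxa : x = a
      · rw [hxa, hka]
      · rw [hk x (by simp [hxa, hx]), map_zero, sub_zero]
    have e : ∀ x y, inner ℂ (ρ (R.inner y x) (k x)) (k y) =
        inner ℂ (ρ (R.inner y x) (M.starProjection (k x))) (M.starProjection (k y)) +
        inner ℂ (ρ (R.inner y x) (k x - M.starProjection (k x))) (k y - M.starProjection (k y)) := by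
      intro x y
      have h3 := (Submodule.mem_orthogonal _ _).1 (hP' (k y)) _ (hM (R.inner y x) _ (hP (k x)))
      have h4 := (Submodule.mem_orthogonal' _ _).1 (hM' (R.inner y x) _ (hP' (k x))) _ (hP (k y))
      rw [map_sub, inner_sub_left] at h4
      rw [inner_sub_right] at h3
      rw [map_sub, inner_sub_left, inner_sub_right, inner_sub_right]
      linear_combination h3 + h4
    simp only [e, Finset.sum_add_distrib, map_add]
    exact add_nonneg h1 h2

/-- The interior tensor product `X ⊗ V` of a right C*-module with a nondegenerate representation,
given by its creation operators `T x : V → X ⊗ V`. -/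
lemma exists_tensor (R : RightCStarModule B X) (hρ : IsFaithfulSigmaRep conv ρ) :
    ∃ (H : Type u) (_ : NormedAddCommGroup H) (_ : InnerProductSpace ℂ H) (_ : CompleteSpace H)
      (T : X →ₗ[ℂ] V →L[ℂ] H), (∀ x y, (T x).adjoint ∘L T y = ρ (R.inner x y)) ∧
        ∀ ξ, (∀ x, (T x).adjoint ξ = 0) → ξ = 0 := by
  -- The tensor product is realized as the reproducing kernel space of `k`. T x is the kernel
  -- section at x and its adjoint is evaluation at x, so a vector killed by all adjoints is the zero
  -- function.
  let k : Matrix X X (V →L[ℂ] V) := .of fun x y => ρ (R.inner x y)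
  have hk : k.PosSemidef := by
    have htfae := (RKHS.posSemidef_tfae (K := k)).out 2 0
    refine htfae.1 ⟨?_, fun f => ?_⟩
    · ext1 x y
      change star (ρ (R.inner y x)) = ρ (R.inner x y)
      rw [← map_star, R.star_inner]
    · exact gram_nonneg R hρ f.support f
  have : Fact k.PosSemidef := ⟨hk⟩
  have hT : ∀ x y, (RKHS.kerFun (RKHS.OfKernel k) x).adjoint ∘L RKHS.kerFun (RKHS.OfKernel k) y =
      ρ (R.inner x y) := fun x y => by
    rw [← RKHS.kernel_apply, RKHS.OfKernel.kernel_ofKernel]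
    rfl
  have hT' : ∀ x y v, RKHS.kerFun (RKHS.OfKernel k) y v x = ρ (R.inner x y) v := fun x y v => by
    rw [← hT, ← RKHS.adjoint_kerFun]
    rfl
  refine ⟨RKHS.OfKernel k, inferInstance, inferInstance, inferInstance,
    { toFun := fun x => RKHS.kerFun (RKHS.OfKernel k) x
      map_add' := fun x y => ?_
      map_smul' := fun c x => ?_ }, hT, fun ξ h => ?_⟩
  · ext1 v
    refine RKHS.ext (H := RKHS.OfKernel k) fun z => ?_
    rw [_root_.add_apply, RKHS.coe_add, Pi.add_apply]
    simp [hT']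
  · ext1 v
    refine RKHS.ext (H := RKHS.OfKernel k) fun z => ?_
    rw [RingHom.id_apply, _root_.smul_apply, RKHS.coe_smul, Pi.smul_apply]
    simp [hT']
  · refine RKHS.ext (H := RKHS.OfKernel k) fun z => ?_
    rw [RKHS.coe_zero, Pi.zero_apply, ← RKHS.adjoint_kerFun]
    exact h z

end Tensor

/-! ### The induced representation of the left algebra -/

section LeftRep

variable {A B X V H : Type u} [NonUnitalCStarAlgebra A] [NonUnitalCStarAlgebra B] [AddCommGroup X] [Module ℂ X]
  [NormedAddCommGroup V] [InnerProductSpace ℂ V] [CompleteSpace V]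
  [NormedAddCommGroup H] [InnerProductSpace ℂ H] [CompleteSpace H]
  {L : LeftCStarModule A X} {R : RightCStarModule B X} {ρ : B →⋆ₙₐ[ℂ] (V →L[ℂ] V)}
  {T : X →ₗ[ℂ] V →L[ℂ] H} {σ : A →⋆ₙₐ[ℂ] (H →L[ℂ] H)}

lemma inner_creation (hT : ∀ x y, (T x).adjoint ∘L T y = ρ (R.inner x y)) (x y : X) (v w : V) :
    inner ℂ (T x v) (T y w) = inner ℂ v (ρ (R.inner x y) w) := by
  rw [← hT, ContinuousLinearMap.comp_apply, ContinuousLinearMap.adjoint_inner_right]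

lemma topologicalClosure_span_creation (hT0 : ∀ ξ, (∀ x, (T x).adjoint ξ = 0) → ξ = 0) :
    (Submodule.span ℂ {ξ : H | ∃ x v, ξ = T x v}).topologicalClosure = ⊤ := by
  rw [Submodule.topologicalClosure_eq_top_iff, Submodule.eq_bot_iff]
  refine fun ξ hξ => hT0 ξ fun x => ext_inner_left ℂ fun v => ?_
  rw [ContinuousLinearMap.adjoint_inner_right, inner_zero_right]
  exact (Submodule.mem_orthogonal _ _).1 hξ _ (Submodule.subset_span ⟨x, v, rfl⟩)

/-- Operators into `H` are equal if they agree after applying all annihilation operators. -/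
lemma eq_of_adjoint_creation {F : Type*} (hT0 : ∀ ξ, (∀ x, (T x).adjoint ξ = 0) → ξ = 0)
    [NormedAddCommGroup F] [NormedSpace ℂ F] {S S' : F →L[ℂ] H}
    (h : ∀ x, (T x).adjoint ∘L S = (T x).adjoint ∘L S') : S = S' := by
  ext ξ
  rw [← sub_eq_zero]
  refine hT0 _ fun x => ?_
  rw [map_sub, sub_eq_zero]
  exact congrArg (fun F => F ξ) (h x)

/-- Operators on `H` are equal if they agree after composition with all creation operators. -/
lemma eq_of_comp_creation {F : Type*} (hT0 : ∀ ξ, (∀ x, (T x).adjoint ξ = 0) → ξ = 0)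
    [NormedAddCommGroup F] [NormedSpace ℂ F] {S S' : H →L[ℂ] F}
    (h : ∀ x, S ∘L T x = S' ∘L T x) : S = S' := by
  refine ContinuousLinearMap.ext_on (Submodule.dense_iff_topologicalClosure_eq_top.2
    (topologicalClosure_span_creation hT0)) ?_
  rintro _ ⟨x, v, rfl⟩
  exact congrArg (fun F => F v) (h x)

lemma RightCStarModule.creation_act
    (hT : ∀ x y, (T x).adjoint ∘L T y = ρ (R.inner x y))
    (hT0 : ∀ ξ, (∀ x, (T x).adjoint ξ = 0) → ξ = 0) (x : X) (b : B) :
    T (R.act x b) = T x ∘L ρ b := by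
  refine eq_of_adjoint_creation hT0 fun w => ?_
  rw [hT, R.inner_act, map_mul, ← hT]
  rfl

variable [SigmaStarAlgebra A] [SigmaStarAlgebra B]

/-- The identity 1 − a*a = (1 − c)² as an identity of forms on elementary tensors. Extended to sums,
the right side becomes a squared norm on the diagonal, which makes a act contractively. -/
lemma IsImprimitivityBimodule.inner_creation_act (h : IsImprimitivityBimodule L R)
    (hT : ∀ x y, (T x).adjoint ∘L T y = ρ (R.inner x y)) {a c : A} (hc : star c = c)
    (hac : c * c = c + c - star a * a) (x y : X) (v w : V) :
    inner ℂ (T x v) (T y w) - inner ℂ (T (L.act a x) v) (T (L.act a y) w) =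
      inner ℂ (T x v - T (L.act c x) v) (T y w - T (L.act c y) w) := by
  have e1 : R.inner (L.act a x) (L.act a y) = R.inner x (L.act (star a * a) y) := by
    rw [h.inner_act_left, L.mul_act]
  have e2 : R.inner (L.act c x) (L.act c y) =
      R.inner x (L.act c y) + R.inner x (L.act c y) - R.inner (L.act a x) (L.act a y) := by
    rw [e1, h.inner_act_left, hc, ← L.mul_act, hac]
    simp
  have e3 : R.inner (L.act c x) y = R.inner x (L.act c y) := by rw [h.inner_act_left, hc]
  simp only [inner_sub_left, inner_sub_right, inner_creation hT, e2, e3, map_add, map_sub,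
    _root_.add_apply, _root_.sub_apply, inner_add_right]
  ring

/-- On formal combinations of pairs (x, v) the action of a is bounded by the seminorm pulled back
from H. Hence it respects the relations of the tensor product and extends continuously. -/
lemma IsImprimitivityBimodule.exists_leftRep_apply (h : IsImprimitivityBimodule L R)
    (hT : ∀ x y, (T x).adjoint ∘L T y = ρ (R.inner x y))
    (hT0 : ∀ ξ, (∀ x, (T x).adjoint ξ = 0) → ξ = 0) (a : A) :
    ∃ S : H →L[ℂ] H, ∀ x, S ∘L T x = T (L.act a x) := by
  let e : (X × V →₀ ℂ) →ₗ[ℂ] H := Finsupp.linearCombination ℂ fun p => T p.1 p.2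
  let f : A → (X × V →₀ ℂ) →ₗ[ℂ] H := fun a =>
    Finsupp.linearCombination ℂ fun p => T (L.act a p.1) p.2
  have hdense : DenseRange e := by
    have h1 : (Set.range e : Set H) =
        (Submodule.span ℂ {ξ : H | ∃ x v, ξ = T x v} : Submodule ℂ H) := by
      rw [← LinearMap.coe_range, Finsupp.range_linearCombination]
      congr 2
      ext ξ
      exact ⟨fun ⟨p, hp⟩ => ⟨p.1, p.2, hp.symm⟩, fun ⟨x, v, hp⟩ => ⟨(x, v), hp.symm⟩⟩
    rw [DenseRange, h1, Submodule.dense_iff_topologicalClosure_eq_top]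
    exact topologicalClosure_span_creation hT0
  have hcontr : ∀ a : A, ‖a‖ ≤ 1 → ∀ v, ‖f a v‖ ≤ ‖e v‖ := by
    intro a ha v
    obtain ⟨c, hc, hac⟩ := exists_isSelfAdjoint_mul_self_eq ha
    have key : ∀ v w, inner ℂ (e v) (e w) - inner ℂ (f a v) (f a w) =
        inner ℂ (e v - f c v) (e w - f c w) := by
      intro v w
      induction v using Finsupp.induction_linear with
      | zero => simp
      | add v v' hv hv' =>
        simp only [map_add, inner_add_left, inner_sub_left] at hv hv' ⊢
        linear_combination hv + hv'
      | single p z =>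
        induction w using Finsupp.induction_linear with
        | zero => simp
        | add w w' hw hw' =>
          simp only [map_add, inner_add_right, inner_sub_right] at hw hw' ⊢
          linear_combination hw + hw'
        | single q z' =>
          have h1 := h.inner_creation_act hT hc hac p.1 q.1 p.2 q.2
          simp only [e, f, Finsupp.linearCombination_single, ← smul_sub, inner_smul_left,
            inner_smul_right]
          rw [← h1]
          ring
    have h1 := congrArg RCLike.re (key v v)
    rw [map_sub, inner_self_eq_norm_sq, inner_self_eq_norm_sq, inner_self_eq_norm_sq] at h1
    exact le_of_sq_le_sq (by nlinarith [sq_nonneg ‖e v - f c v‖]) (norm_nonneg _)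
  have hbound : ∀ v, ‖f a v‖ ≤ (‖a‖ + 1) * ‖e v‖ := by
    intro v
    have hpos : 0 < ‖a‖ + 1 := by positivity
    -- Normalizing by ‖a‖ + 1 instead of ‖a‖ avoids a separate case a = 0.
    let z : ℂ := ((‖a‖ + 1 : ℝ) : ℂ)
    have hz : ‖z‖ = ‖a‖ + 1 := by
      rw [Complex.norm_real, Real.norm_of_nonneg hpos.le]
    have hz0 : z ≠ 0 := by rw [← norm_ne_zero_iff, hz]; exact hpos.ne'
    have h1 : f a v = z • f (z⁻¹ • a) v := by
      have h2 : f (z⁻¹ • a) = z⁻¹ • f a := by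
        ext p
        simp [f]
      rw [h2, LinearMap.smul_apply, smul_smul, mul_inv_cancel₀ hz0, one_smul]
    rw [h1, norm_smul, hz]
    gcongr
    refine hcontr _ ?_ v
    rw [norm_smul, norm_inv, hz, inv_mul_le_one₀ hpos]
    linarith
  refine ⟨(f a).extendOfNorm e, fun x => ?_⟩
  ext v
  have h1 := LinearMap.extendOfNorm_eq (f := f a) hdense ⟨_, hbound⟩ (Finsupp.single (x, v) 1)
  simpa [e, f] using h1

/-- The representation of `A` on `X ⊗ V` that is induced by the left action of `A` on `X`. -/
lemma IsImprimitivityBimodule.exists_leftRep (h : IsImprimitivityBimodule L R)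
    (hT : ∀ x y, (T x).adjoint ∘L T y = ρ (R.inner x y))
    (hT0 : ∀ ξ, (∀ x, (T x).adjoint ξ = 0) → ξ = 0) :
    ∃ σ : A →⋆ₙₐ[ℂ] (H →L[ℂ] H), ∀ a x, σ a ∘L T x = T (L.act a x) := by
  choose s hs using h.exists_leftRep_apply hT hT0
  refine ⟨
    { toFun := s
      map_smul' := fun z a => eq_of_comp_creation hT0 fun x => ?_
      map_zero' := eq_of_comp_creation hT0 fun x => ?_
      map_add' := fun a b => eq_of_comp_creation hT0 fun x => ?_
      map_mul' := fun a b => eq_of_comp_creation hT0 fun x => ?_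
      map_star' := fun a => eq_of_comp_creation hT0 fun x =>
        eq_of_adjoint_creation hT0 fun y => ?_ }, hs⟩
  · rw [hs, ContinuousLinearMap.smul_comp, MonoidHom.id_apply, hs]
    simp
  · rw [hs]
    simp
  · rw [hs, ContinuousLinearMap.add_comp, hs, hs]
    simp
  · rw [hs, ContinuousLinearMap.mul_def, ContinuousLinearMap.comp_assoc, hs, hs, L.mul_act]
  · rw [hs, hT, ← h.inner_act_left, ← hT, ← hs, ContinuousLinearMap.adjoint_comp,
      ContinuousLinearMap.star_eq_adjoint, ContinuousLinearMap.comp_assoc]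

/-- The bimodule identity ⟨x|y⟩z = x⟨y|z⟩, read on creation operators. -/
lemma IsImprimitivityBimodule.leftRep_inner (h : IsImprimitivityBimodule L R)
    (hT : ∀ x y, (T x).adjoint ∘L T y = ρ (R.inner x y))
    (hT0 : ∀ ξ, (∀ x, (T x).adjoint ξ = 0) → ξ = 0)
    (hσ : ∀ a x, σ a ∘L T x = T (L.act a x)) (x y : X) :
    σ (L.inner x y) = T x ∘L (T y).adjoint := by
  refine eq_of_comp_creation hT0 fun z => eq_of_adjoint_creation hT0 fun w => ?_
  rw [hσ, h.inner_act_eq, hT, R.inner_act, map_mul, ← hT, ← hT]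
  rfl

/-- WOT-limits of creation operators are creation operators. -/
lemma IsImprimitivityBimodule.exists_modTendsto (h : IsImprimitivityBimodule L R)
    (hρ : IsFaithfulSigmaRep sigmaTendsto ρ)
    (hT : ∀ x y, (T x).adjoint ∘L T y = ρ (R.inner x y))
    (hT0 : ∀ ξ, (∀ x, (T x).adjoint ξ = 0) → ξ = 0) {w : ℕ → X} {S : V →L[ℂ] H}
    (hS : ∀ y, WOTTendsto (fun n => (T y).adjoint ∘L T (w n)) ((T y).adjoint ∘L S)) :
    ∃ x, R.ModTendsto w x ∧ S = T x := by
  -- T_y* T_{w_n} = ρ(⟨y|w_n⟩), so the limits lie in the WOT-closed range of ρ. The right Σ*-module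
  -- property then supplies the vector x.
  have h1 : ∀ y, ∃ b, ρ b = (T y).adjoint ∘L S ∧ sigmaTendsto (fun n => R.inner y (w n)) b := by
    intro y
    have h2 := hS y
    simp only [hT] at h2
    obtain ⟨b, hb⟩ := hρ.range_closed _ _ h2
    exact ⟨b, hb, (hρ.conv_iff _ _).2 (by rwa [hb])⟩
  choose b hb hwb using h1
  obtain ⟨x, hx⟩ := h.right_isSigmaModule w fun y =>
    ⟨star (b y), by simpa only [R.star_inner] using sigmaTendsto_star (hwb y)⟩
  refine ⟨x, hx, eq_of_adjoint_creation hT0 fun y => ?_⟩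
  rw [← hb, hT]
  congr 1
  refine sigmaTendsto_unique (hwb y) ?_
  simpa only [R.star_inner] using sigmaTendsto_star (hx y)

/-- The induced representation realizes `A` as a concrete Σ*-algebra. -/
lemma IsImprimitivityBimodule.isFaithfulSigmaRep_leftRep (h : IsImprimitivityBimodule L R)
    (hρ : IsFaithfulSigmaRep sigmaTendsto ρ)
    (hT : ∀ x y, (T x).adjoint ∘L T y = ρ (R.inner x y))
    (hT0 : ∀ ξ, (∀ x, (T x).adjoint ξ = 0) → ξ = 0)
    (hσ : ∀ a x, σ a ∘L T x = T (L.act a x)) : IsFaithfulSigmaRep sigmaTendsto σ := by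
  have hTinj : ∀ x, T x = 0 → x = 0 := fun x hx => by
    refine R.inner_self_eq_zero x (hρ.injective ?_)
    rw [← hT, hx, ContinuousLinearMap.comp_zero, map_zero]
  have hinj : Function.Injective σ := by
    refine (injective_iff_map_eq_zero σ).2 fun a ha => ?_
    refine h.left_isSigmaFull.eq_zero_of_act fun x => hTinj _ ?_
    rw [← hσ, ha, ContinuousLinearMap.zero_comp]
  have hσn : ∀ a, ‖σ a‖ = ‖a‖ := fun a => NonUnitalStarAlgHom.norm_map σ hinj a
  have hforward : ∀ (b : ℕ → A) (a : A), sigmaTendsto b a → WOTTendsto (fun n => σ (b n)) (σ a) := by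
    intro b a hba
    obtain ⟨M, hM⟩ := sigmaTendsto_bounded hba
    refine wotTendsto_of_total (M := M) (fun n => (hσn _).trans_le (hM n))
      (topologicalClosure_span_creation hT0) (topologicalClosure_span_creation hT0) ?_
    rintro _ ⟨x, v, rfl⟩ _ ⟨y, v', rfl⟩
    -- Convergence of b_n x to ax is clear for the left inner products. The compatibility axiom
    -- passes it to the right ones, which ρ turns into WOT-convergence.
    have h1 : L.ModTendsto (fun n => L.act (b n) x) (L.act a x) := fun z => by
      simpa only [L.inner_act] using sigmaTendsto_mul_right hba (L.inner x z)
    have h2 := sigmaTendsto_star ((h.modTendsto_iff _ _).1 h1 y)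
    simp only [R.star_inner] at h2
    rw [hρ.conv_iff, wotTendsto_iff] at h2
    have e : ∀ a, σ a (T x v) = T (L.act a x) v := fun a => congrArg (fun F => F v) (hσ a x)
    simp only [e, inner_creation hT]
    exact h2 v v'
  have hlim : ∀ (b : ℕ → A) (S : H →L[ℂ] H), WOTTendsto (fun n => σ (b n)) S →
      ∃ a, sigmaTendsto b a ∧ σ a = S := by
    intro b S hS
    obtain ⟨M, hM⟩ := hS.bounded
    obtain ⟨a, ha⟩ := exists_sigmaTendsto_of_mul (u := b) (M := M)
      (fun n => (hσn _).symm.trans_le (hM n)) fun n => by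
        have h1 : (Submodule.span ℂ {a : A | ∃ x y, a = L.inner x y} : Set A) ⊆
            {d | ∃ l, sigmaTendsto (fun m => b m * star d) l} := by
          intro c hc
          induction hc using Submodule.span_induction with
          | mem c hc =>
            obtain ⟨y, x, rfl⟩ := hc
            -- The sequence b_n x converges in the right module to some z. The compatibility axiom,
            -- used in the other direction, gives σ-convergence of b_n⟨x|y⟩ to ⟨z|y⟩ in A.
            obtain ⟨z, hz, -⟩ := h.exists_modTendsto hρ hT hT0 (w := fun n => L.act (b n) x)
              (S := S ∘L T x) fun y => by
                simp only [← hσ]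
                exact hS.adjoint_comp_comp (T y) (T x)
            refine ⟨L.inner z y, ?_⟩
            simpa only [L.inner_act, L.star_inner] using (h.modTendsto_iff _ _).2 hz y
          | zero => exact ⟨0, by simpa using sigmaTendsto_const (0 : A)⟩
          | add c d _ _ hc hd =>
            obtain ⟨l, hl⟩ := hc
            obtain ⟨l', hl'⟩ := hd
            exact ⟨l + l', by simpa [mul_add] using sigmaTendsto_add hl hl'⟩
          | smul z c _ hc =>
            obtain ⟨l, hl⟩ := hc
            exact ⟨star z • l, by simpa [mul_smul_comm] using sigmaTendsto_smul (star z) hl⟩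
        have h2 : sigmaClosure {d | ∃ l, sigmaTendsto (fun m => b m * star d) l} = Set.univ :=
          h.left_isSigmaFull.eq_univ (isSigmaClosed_sigmaClosure _)
            (h1.trans (subset_sigmaClosure _))
        rw [h2]
        trivial
    exact ⟨a, ha, (hforward b a ha).unique hS⟩
  refine ⟨hinj, ?_, fun b S hS => ?_, fun b a => ⟨hforward b a, fun hS => ?_⟩⟩
  · rw [Submodule.topologicalClosure_eq_top_iff, Submodule.eq_bot_iff]
    refine fun ξ hξ => hT0 ξ fun x => ?_
    -- Orthogonality of ξ to σ(⟨x|x⟩)ξ = T_x T_x* ξ means T_x* ξ = 0.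
    have h1 := (Submodule.mem_orthogonal _ _).1 hξ _
      (Submodule.subset_span ⟨L.inner x x, ξ, rfl⟩)
    rw [h.leftRep_inner hT hT0 hσ, ContinuousLinearMap.comp_apply,
      ← ContinuousLinearMap.adjoint_inner_right] at h1
    exact inner_self_eq_zero.1 h1
  · obtain ⟨a, -, ha⟩ := hlim b S hS
    exact ⟨a, ha⟩
  · obtain ⟨a', ha', e⟩ := hlim b _ hS
    rwa [← hinj e]

end LeftRep

/-! ### Recognizing complementary full corners -/

section Recognition

variable {C D : Type u} [NonUnitalCStarAlgebra C] {p : 𝓜(ℂ, C)}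

/-- For an approximate unit (e), the products ec = e(pc) lie in CpC and tend to c in norm. -/
lemma mem_closure_cornerIdeal_of_fst {c : C} (h : p.fst c = c) :
    c ∈ (cornerIdeal p).topologicalClosure := by
  let := CStarAlgebra.spectralOrder C
  have := CStarAlgebra.spectralOrderedRing C
  have hu := (CStarAlgebra.increasingApproximateUnit C).toIsApproximateUnit
  have := hu.neBot
  refine mem_closure_of_tendsto (hu.tendsto_mul_right c) (Eventually.of_forall fun e => ?_)
  exact Submodule.subset_span ⟨e, c, by rw [h]⟩

lemma mem_closure_cornerIdeal_of_snd {c : C} (h : p.snd c = c) :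
    c ∈ (cornerIdeal p).topologicalClosure := by
  let := CStarAlgebra.spectralOrder C
  have := CStarAlgebra.spectralOrderedRing C
  have hu := (CStarAlgebra.increasingApproximateUnit C).toIsApproximateUnit
  have := hu.neBot
  refine mem_closure_of_tendsto (hu.tendsto_mul_left c) (Eventually.of_forall fun e => ?_)
  exact Submodule.subset_span ⟨c, e, by rw [← p.central, h]⟩

variable [SigmaStarAlgebra C] [NonUnitalCStarAlgebra D] [SigmaStarAlgebra D]

/-- A corner `pCp` is σ-full if the complementary corner is the image of a Σ*-algebra in which
the inverse image of `CpC` contains a σ-dense subspace. -/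
lemma isSigmaDense_cornerIdeal (hp : IsStarProjection p) {e : D →⋆ₙₐ[ℂ] C}
    (he : SigmaContinuous e) {S : Set D} (hS : IsSigmaDense (Submodule.span ℂ S : Set D))
    (heS : ∀ d ∈ S, e d ∈ cornerIdeal p)
    (hq : ∀ c, ∃ d, e d = (1 - p).fst ((1 - p).snd c)) :
    IsSigmaDense (cornerIdeal p : Set C) := by
  refine Set.eq_univ_of_forall fun c => Set.mem_sInter.2 ?_
  rintro T ⟨hT, hST⟩
  have hcl : ∀ d ∈ (cornerIdeal p).topologicalClosure, d ∈ T := fun d hd =>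
    closure_minimal hST hT.isClosed hd
  let r := p.fst c + (p.snd c - p.fst (p.snd c))
  have hr : r ∈ (cornerIdeal p).topologicalClosure := by
    refine add_mem (mem_closure_cornerIdeal_of_fst (fst_fst hp c))
      (mem_closure_cornerIdeal_of_snd ?_)
    rw [map_sub, ← fst_snd_comm, snd_snd hp]
  obtain ⟨d, hd⟩ := hq c
  -- Here c = r + (1 − p)c(1 − p), with `r` in the norm closure of CpC. For fixed `r` the map d ↦ r
  -- + e(d) is σ-continuous, so density in `D` takes care of the remaining corner.
  have h1 : {d | r + e d ∈ T} = Set.univ := by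
    refine hS.eq_univ (fun b a hb hba => hT _ _ hb
      (sigmaTendsto_add (sigmaTendsto_const r) (he _ _ hba))) fun d hd => hcl _ (add_mem hr ?_)
    induction hd using Submodule.span_induction with
    | mem d hd => exact Submodule.le_topologicalClosure _ (heS d hd)
    | zero => simp
    | add d d' _ _ hd hd' => rw [map_add]; exact add_mem hd hd'
    | smul z d _ hd => rw [map_smul]; exact Submodule.smul_mem _ z hd
  have h2 : d ∈ {d | r + e d ∈ T} := h1 ▸ Set.mem_univ d
  rw [Set.mem_ofPred_eq, hd] at h2
  convert h2 using 1
  have e1 : (1 - p).fst ((1 - p).snd c) = (c - p.snd c) - p.fst (c - p.snd c) := rfl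
  rw [e1, map_sub]
  simp only [r]
  abel

lemma sigmaIsomorphic_corner (hp : IsStarProjection p) {e : D →⋆ₙₐ[ℂ] C}
    (hinj : Function.Injective e)
    (he : ∀ b a, sigmaTendsto (fun n => e (b n)) (e a) ↔ sigmaTendsto b a)
    (hmem : ∀ d, p.fst (e d) = e d ∧ p.snd (e d) = e d)
    (hsurj : ∀ c, ∃ d, e d = p.fst (p.snd c)) :
    SigmaIsomorphic D (corner p hp) := by
  let f : D →⋆ₙₐ[ℂ] corner p hp :=
    NonUnitalStarAlgHom.codRestrict e (corner p hp) fun d => (mem_cornerSpace hp hp).2 (hmem d)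
  have hf : ∀ d, (f d : C) = e d := fun d => rfl
  have hbij : Function.Bijective f := by
    refine ⟨fun d d' hdd => hinj (congrArg Subtype.val hdd), ?_⟩
    rintro ⟨_, c, rfl⟩
    obtain ⟨d, hd⟩ := hsurj c
    exact ⟨d, Subtype.ext hd⟩
  let φ : D ≃⋆ₐ[ℂ] corner p hp := StarAlgEquiv.ofBijective f hbij
  have hφ : ∀ b a, sigmaTendsto (fun n => φ (b n)) (φ a) ↔ sigmaTendsto b a := he
  refine ⟨φ, fun b a h => (hφ b a).2 h, fun b a h => (hφ _ _).1 ?_⟩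
  simpa only [StarAlgEquiv.apply_symm_apply] using h

end Recognition

/-! ### The linking algebra -/

section Linking

lemma exists_orthogonal_sum (H V : Type u) [NormedAddCommGroup H] [InnerProductSpace ℂ H]
    [CompleteSpace H] [NormedAddCommGroup V] [InnerProductSpace ℂ V] [CompleteSpace V] :
    ∃ (E : Type u) (_ : NormedAddCommGroup E) (_ : InnerProductSpace ℂ E) (_ : CompleteSpace E)
      (i : H →L[ℂ] E) (j : V →L[ℂ] E), i.adjoint ∘L i = .id ℂ H ∧ j.adjoint ∘L j = .id ℂ V ∧
        i.adjoint ∘L j = 0 ∧ i ∘L i.adjoint + j ∘L j.adjoint = .id ℂ E := by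
  let ε := WithLp.prodContinuousLinearEquiv 2 ℂ H V
  let i : H →L[ℂ] WithLp 2 (H × V) := ε.symm.toContinuousLinearMap ∘L .inl ℂ H V
  let j : V →L[ℂ] WithLp 2 (H × V) := ε.symm.toContinuousLinearMap ∘L .inr ℂ H V
  have hi : i.adjoint = .fst ℂ H V ∘L ε.toContinuousLinearMap := by
    symm
    rw [ContinuousLinearMap.eq_adjoint_iff]
    intro x y
    simp [i, ε, WithLp.prod_inner_apply]
  have hj : j.adjoint = .snd ℂ H V ∘L ε.toContinuousLinearMap := by
    symm
    rw [ContinuousLinearMap.eq_adjoint_iff]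
    intro x y
    simp [j, ε, WithLp.prod_inner_apply]
  refine ⟨WithLp 2 (H × V), inferInstance, inferInstance, inferInstance, i, j, ?_, ?_, ?_, ?_⟩
  · rw [hi]; ext x; simp [i]
  · rw [hj]; ext x; simp [j]
  · rw [hi]; ext x; simp [j]
  · rw [hi, hj]
    ext x
    apply ε.injective
    simp [i, j]

lemma adjoint_corner {F G : Type*} [NormedAddCommGroup F] [InnerProductSpace ℂ F] [CompleteSpace F]
    [NormedAddCommGroup G] [InnerProductSpace ℂ G] [CompleteSpace G] {E : Type*} [NormedAddCommGroup E]
    [InnerProductSpace ℂ E] [CompleteSpace E] (u : G →L[ℂ] E)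
    (S : E →L[ℂ] E) (v : F →L[ℂ] E) :
    u.adjoint ∘L (star S) ∘L v = (v.adjoint ∘L S ∘L u).adjoint := by
  rw [ContinuousLinearMap.adjoint_comp, ContinuousLinearMap.adjoint_comp,
    ContinuousLinearMap.adjoint_adjoint, ContinuousLinearMap.star_eq_adjoint,
    ContinuousLinearMap.comp_assoc]

variable {A B X V H E : Type u} [NonUnitalCStarAlgebra A] [SigmaStarAlgebra A]
  [NonUnitalCStarAlgebra B] [SigmaStarAlgebra B] [AddCommGroup X] [Module ℂ X]
  [NormedAddCommGroup V] [InnerProductSpace ℂ V] [CompleteSpace V]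
  [NormedAddCommGroup H] [InnerProductSpace ℂ H] [CompleteSpace H]
  [NormedAddCommGroup E] [InnerProductSpace ℂ E] [CompleteSpace E]

/-- Compatible representations of the two algebras and of the bimodule of an imprimitivity
bimodule, on the two summands of a Hilbert space `E`. -/
structure IsLinkingRep (L : LeftCStarModule A X) (R : RightCStarModule B X)
    (σ : A →⋆ₙₐ[ℂ] (H →L[ℂ] H)) (ρ : B →⋆ₙₐ[ℂ] (V →L[ℂ] V)) (T : X →ₗ[ℂ] V →L[ℂ] H)
    (i : H →L[ℂ] E) (j : V →L[ℂ] E) : Prop where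
  bimodule : IsImprimitivityBimodule L R
  left_rep : IsFaithfulSigmaRep sigmaTendsto σ
  right_rep : IsFaithfulSigmaRep sigmaTendsto ρ
  adjoint_comp : ∀ x y, (T x).adjoint ∘L T y = ρ (R.inner x y)
  separating : ∀ ξ, (∀ x, (T x).adjoint ξ = 0) → ξ = 0
  left_comp : ∀ a x, σ a ∘L T x = T (L.act a x)
  isometry_left : i.adjoint ∘L i = .id ℂ H
  isometry_right : j.adjoint ∘L j = .id ℂ V
  orthogonal : i.adjoint ∘L j = 0
  add_eq_id : i ∘L i.adjoint + j ∘L j.adjoint = .id ℂ E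

variable {L : LeftCStarModule A X} {R : RightCStarModule B X} {σ : A →⋆ₙₐ[ℂ] (H →L[ℂ] H)}
  {ρ : B →⋆ₙₐ[ℂ] (V →L[ℂ] V)} {T : X →ₗ[ℂ] V →L[ℂ] H} {i : H →L[ℂ] E} {j : V →L[ℂ] E}

lemma IsImprimitivityBimodule.exists_isLinkingRep (h : IsImprimitivityBimodule L R) :
    ∃ (H V E : Type u) (_ : NormedAddCommGroup H) (_ : InnerProductSpace ℂ H)
      (_ : CompleteSpace H) (_ : NormedAddCommGroup V) (_ : InnerProductSpace ℂ V)
      (_ : CompleteSpace V) (_ : NormedAddCommGroup E) (_ : InnerProductSpace ℂ E)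
      (_ : CompleteSpace E) (σ : A →⋆ₙₐ[ℂ] (H →L[ℂ] H)) (ρ : B →⋆ₙₐ[ℂ] (V →L[ℂ] V))
      (T : X →ₗ[ℂ] V →L[ℂ] H) (i : H →L[ℂ] E) (j : V →L[ℂ] E), IsLinkingRep L R σ ρ T i j := by
  obtain ⟨V, _, _, _, ρ, hρ⟩ := exists_rep (A := B)
  obtain ⟨H, _, _, _, T, hT, hT0⟩ := exists_tensor R hρ
  obtain ⟨σ, hσ⟩ := h.exists_leftRep hT hT0
  obtain ⟨E, _, _, _, i, j, h1, h2, h3, h4⟩ := exists_orthogonal_sum H V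
  exact ⟨H, V, E, _, _, inferInstance, _, _, inferInstance, _, _, inferInstance, σ, ρ, T, i, j,
    h, h.isFaithfulSigmaRep_leftRep hρ hT hT0 hσ, hρ, hT, hT0, hσ, h1, h2, h3, h4⟩

namespace IsLinkingRep

variable (D : IsLinkingRep L R σ ρ T i j)
include D

lemma orthogonal' : j.adjoint ∘L i = 0 := by
  have := congrArg ContinuousLinearMap.adjoint D.orthogonal
  simpa [ContinuousLinearMap.adjoint_comp] using this

lemma eq_sum (ξ : E) : ξ = i (i.adjoint ξ) + j (j.adjoint ξ) :=
  (congrArg (fun F => F ξ) D.add_eq_id).symm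

lemma left_left (ξ : H) : i.adjoint (i ξ) = ξ := congrArg (fun F => F ξ) D.isometry_left

lemma right_right (ξ : V) : j.adjoint (j ξ) = ξ := congrArg (fun F => F ξ) D.isometry_right

lemma left_right (ξ : V) : i.adjoint (j ξ) = 0 := congrArg (fun F => F ξ) D.orthogonal

lemma right_left (ξ : H) : j.adjoint (i ξ) = 0 := congrArg (fun F => F ξ) D.orthogonal'

/-- Block matrix multiplication, obtained by inserting ii* + jj* = 1 between the factors. -/
lemma corner_mul {F G : Type*} [NormedAddCommGroup F] [NormedSpace ℂ F]
    [NormedAddCommGroup G] [NormedSpace ℂ G] (u : E →L[ℂ] G) (S S' : E →L[ℂ] E) (v : F →L[ℂ] E) :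
    u ∘L (S * S') ∘L v = (u ∘L S ∘L i) ∘L (i.adjoint ∘L S' ∘L v) +
      (u ∘L S ∘L j) ∘L (j.adjoint ∘L S' ∘L v) := by
  ext ξ
  have := congrArg (fun η => u (S η)) (D.eq_sum (S' (v ξ)))
  simpa using this

lemma adjoint_comp_left (a : A) (y : X) :
    (T y).adjoint ∘L σ a = (T (L.act (star a) y)).adjoint := by
  rw [← D.left_comp, ContinuousLinearMap.adjoint_comp, map_star,
    ContinuousLinearMap.star_eq_adjoint, ContinuousLinearMap.adjoint_adjoint]

lemma right_comp (x : X) (b : B) : T x ∘L ρ b = T (R.act x b) :=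
  (RightCStarModule.creation_act D.adjoint_comp D.separating x b).symm

lemma right_comp_adjoint (b : B) (y : X) :
    ρ b ∘L (T y).adjoint = (T (R.act y (star b))).adjoint := by
  rw [← D.right_comp, ContinuousLinearMap.adjoint_comp, map_star,
    ContinuousLinearMap.star_eq_adjoint, ContinuousLinearMap.adjoint_adjoint]

lemma comp_adjoint (x y : X) : T x ∘L (T y).adjoint = σ (L.inner x y) :=
  (D.bimodule.leftRep_inner D.adjoint_comp D.separating D.left_comp x y).symm

/-- The linking algebra of an imprimitivity bimodule, as an algebra of operators. -/
def algebra : NonUnitalStarSubalgebra ℂ (E →L[ℂ] E) where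
  carrier := {S | (∃ a, i.adjoint ∘L S ∘L i = σ a) ∧ (∃ x, i.adjoint ∘L S ∘L j = T x) ∧
    (∃ y, j.adjoint ∘L S ∘L i = (T y).adjoint) ∧ ∃ b, j.adjoint ∘L S ∘L j = ρ b}
  zero_mem' := ⟨⟨0, by simp⟩, ⟨0, by simp⟩, ⟨0, by simp⟩, ⟨0, by simp⟩⟩
  add_mem' := by
    rintro S S' ⟨⟨a, ha⟩, ⟨x, hx⟩, ⟨y, hy⟩, b, hb⟩ ⟨⟨a', ha'⟩, ⟨x', hx'⟩, ⟨y', hy'⟩, b', hb'⟩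
    exact ⟨⟨a + a', by simp [← ha, ← ha']⟩, ⟨x + x', by simp [← hx, ← hx']⟩,
      ⟨y + y', by simp [← hy, ← hy']⟩, ⟨b + b', by simp [← hb, ← hb']⟩⟩
  smul_mem' := by
    rintro z S ⟨⟨a, ha⟩, ⟨x, hx⟩, ⟨y, hy⟩, b, hb⟩
    exact ⟨⟨z • a, by simp [← ha]⟩, ⟨z • x, by simp [← hx]⟩,
      ⟨star z • y, by
        rw [ContinuousLinearMap.smul_comp, ContinuousLinearMap.comp_smul, hy, map_smul, map_smulₛₗ,
          starRingEnd_apply, star_star]⟩, ⟨z • b, by simp [← hb]⟩⟩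
  mul_mem' := by
    rintro S S' ⟨⟨a, ha⟩, ⟨x, hx⟩, ⟨y, hy⟩, b, hb⟩ ⟨⟨a', ha'⟩, ⟨x', hx'⟩, ⟨y', hy'⟩, b', hb'⟩
    -- These are the entries of the product of the matrices with rows (a, x), (y*, b) and (a', x'),
    -- (y'*, b'). The lower left entry is y*a' + by'*, the adjoint of a'*y + y'b*.
    refine ⟨⟨a * a' + L.inner x y', ?_⟩, ⟨L.act a x' + R.act x b', ?_⟩,
      ⟨L.act (star a') y + R.act y' (star b), ?_⟩, ⟨R.inner y x' + b * b', ?_⟩⟩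
    · rw [D.corner_mul, ha, hx, ha', hy', D.comp_adjoint, map_add, map_mul]; rfl
    · rw [D.corner_mul, ha, hx, hx', hb', D.left_comp, D.right_comp, map_add]
    · rw [D.corner_mul, hy, hb, ha', hy', D.adjoint_comp_left, D.right_comp_adjoint, map_add,
        map_add]
    · rw [D.corner_mul, hy, hb, hx', hb', D.adjoint_comp, map_add, map_mul]; rfl
  star_mem' := by
    rintro S ⟨⟨a, ha⟩, ⟨x, hx⟩, ⟨y, hy⟩, b, hb⟩
    refine ⟨⟨star a, ?_⟩, ⟨y, ?_⟩, ⟨x, ?_⟩, ⟨star b, ?_⟩⟩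
    · rw [adjoint_corner, ha, map_star, ContinuousLinearMap.star_eq_adjoint]
    · rw [adjoint_corner, hy, ContinuousLinearMap.adjoint_adjoint]
    · rw [adjoint_corner, hx]
    · rw [adjoint_corner, hb, map_star, ContinuousLinearMap.star_eq_adjoint]

lemma mem_algebra {S : E →L[ℂ] E} : S ∈ D.algebra ↔ (∃ a, i.adjoint ∘L S ∘L i = σ a) ∧
    (∃ x, i.adjoint ∘L S ∘L j = T x) ∧ (∃ y, j.adjoint ∘L S ∘L i = (T y).adjoint) ∧
      ∃ b, j.adjoint ∘L S ∘L j = ρ b := Iff.rfl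

/-- After multiplication by T_y* on the left, the corners become T_y* T_{x_n} and converge in the
WOT on V. The Σ*-module property then keeps the limit among the creation operators. -/
lemma exists_creation_of_wotTendsto {S : ℕ → E →L[ℂ] E} {S₀ : E →L[ℂ] E} (h : WOTTendsto S S₀)
    (hS : ∀ n, ∃ x, i.adjoint ∘L S n ∘L j = T x) : ∃ x, i.adjoint ∘L S₀ ∘L j = T x := by
  choose x hx using hS
  obtain ⟨z, -, hz⟩ := D.bimodule.exists_modTendsto D.right_rep D.adjoint_comp D.separating
    (w := x) (S := i.adjoint ∘L S₀ ∘L j) fun y => by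
      have h1 := h.adjoint_comp_comp (i ∘L T y) j
      simp only [ContinuousLinearMap.adjoint_comp, ContinuousLinearMap.comp_assoc] at h1
      simpa only [hx] using h1
  exact ⟨z, hz⟩

/-- Compressions are WOT-continuous, so it suffices that each entry space is sequentially closed.
The diagonal ones are ranges of Σ*-representations. The lower left entry is treated as the adjoint
of the upper right entry of the adjoint sequence. -/
lemma mem_algebra_of_wotTendsto {S : ℕ → E →L[ℂ] E} {S₀ : E →L[ℂ] E} (h : WOTTendsto S S₀)
    (hS : ∀ n, S n ∈ D.algebra) : S₀ ∈ D.algebra := by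
  simp only [D.mem_algebra] at hS ⊢
  refine ⟨?_, D.exists_creation_of_wotTendsto h fun n => (hS n).2.1, ?_, ?_⟩
  · choose a ha using fun n => (hS n).1
    have h1 := h.adjoint_comp_comp i i
    simp only [ha] at h1
    obtain ⟨a, ha⟩ := D.left_rep.range_closed _ _ h1
    exact ⟨a, ha.symm⟩
  · obtain ⟨y, hy⟩ := D.exists_creation_of_wotTendsto h.star fun n => by
      obtain ⟨y, hy⟩ := (hS n).2.2.1
      exact ⟨y, by rw [adjoint_corner, hy, ContinuousLinearMap.adjoint_adjoint]⟩
    refine ⟨y, ?_⟩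
    rw [← hy, adjoint_corner, ContinuousLinearMap.adjoint_adjoint]
  · choose b hb using fun n => (hS n).2.2.2
    have h1 := h.adjoint_comp_comp j j
    simp only [hb] at h1
    obtain ⟨b, hb⟩ := D.right_rep.range_closed _ _ h1
    exact ⟨b, hb.symm⟩

lemma isClosed_algebra : IsClosed (D.algebra : Set (E →L[ℂ] E)) := by
  rw [← isSeqClosed_iff_isClosed]
  exact fun S S₀ hS h => D.mem_algebra_of_wotTendsto (wotTendsto_of_tendsto h) hS

end IsLinkingRep

end Linking

/-! ### Inflation of representations along isometries -/

section Conj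

variable {D G E : Type*} [NonUnitalCStarAlgebra D]
  [NormedAddCommGroup G] [InnerProductSpace ℂ G] [CompleteSpace G]
  [NormedAddCommGroup E] [InnerProductSpace ℂ E] [CompleteSpace E]

/-- The representation on `E` induced from a representation on `G` by an isometry `G → E`. -/
def inflate (k : G →L[ℂ] E) (hk : k.adjoint ∘L k = .id ℂ G) (τ : D →⋆ₙₐ[ℂ] (G →L[ℂ] G)) :
    D →⋆ₙₐ[ℂ] (E →L[ℂ] E) where
  toFun d := k ∘L τ d ∘L k.adjoint
  map_smul' c d := by ext; simp
  map_zero' := by ext; simp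
  map_add' c d := by ext; simp
  map_mul' c d := by
    ext ξ
    have := congrArg (fun F => F (τ d (k.adjoint ξ))) hk
    simp only [ContinuousLinearMap.comp_apply, ContinuousLinearMap.id_apply] at this
    simp [this]
  map_star' d := by
    have := adjoint_corner k.adjoint (τ d) k.adjoint
    rw [ContinuousLinearMap.adjoint_adjoint] at this
    rw [map_star, this, ContinuousLinearMap.star_eq_adjoint]

variable {k : G →L[ℂ] E} (hk : k.adjoint ∘L k = .id ℂ G) (τ : D →⋆ₙₐ[ℂ] (G →L[ℂ] G))

lemma inflate_apply (d : D) : inflate k hk τ d = k ∘L τ d ∘L k.adjoint := rfl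

lemma adjoint_inflate (d : D) : k.adjoint ∘L inflate k hk τ d ∘L k = τ d := by
  ext ξ
  have : ∀ ξ, k.adjoint (k ξ) = ξ := fun ξ => congrArg (fun F => F ξ) hk
  simp [inflate_apply, this]

variable {τ} in
lemma inflate_injective (hτ : Function.Injective τ) : Function.Injective (inflate k hk τ) :=
  fun a a' h => hτ (by rw [← adjoint_inflate hk τ a, h, adjoint_inflate])

/-- Inflation and the compression that undoes it both have the WOT-continuous form S ↦ V* S W. -/
lemma wotTendsto_inflate_iff {b : ℕ → D} {a : D} :
    WOTTendsto (fun n => inflate k hk τ (b n)) (inflate k hk τ a) ↔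
      WOTTendsto (fun n => τ (b n)) (τ a) := by
  constructor
  · intro h
    simpa only [adjoint_inflate] using h.adjoint_comp_comp k k
  · intro h
    simpa only [inflate_apply, ContinuousLinearMap.adjoint_adjoint] using
      h.adjoint_comp_comp k.adjoint k.adjoint

end Conj

/-! ### The linking algebra as a Σ*-algebra, and its two corners -/

namespace IsLinkingRep

variable {A B X V H E : Type u} [NonUnitalCStarAlgebra A] [SigmaStarAlgebra A]
  [NonUnitalCStarAlgebra B] [SigmaStarAlgebra B] [AddCommGroup X] [Module ℂ X]
  [NormedAddCommGroup V] [InnerProductSpace ℂ V] [CompleteSpace V]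
  [NormedAddCommGroup H] [InnerProductSpace ℂ H] [CompleteSpace H]
  [NormedAddCommGroup E] [InnerProductSpace ℂ E] [CompleteSpace E]
  {L : LeftCStarModule A X} {R : RightCStarModule B X} {σ : A →⋆ₙₐ[ℂ] (H →L[ℂ] H)}
  {ρ : B →⋆ₙₐ[ℂ] (V →L[ℂ] V)} {T : X →ₗ[ℂ] V →L[ℂ] H} {i : H →L[ℂ] E} {j : V →L[ℂ] E}
  (D : IsLinkingRep L R σ ρ T i j)

instance : IsClosed (D.algebra : Set (E →L[ℂ] E)) := D.isClosed_algebra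

/-- The inclusion of the left algebra into the linking algebra. -/
def leftHom : A →⋆ₙₐ[ℂ] D.algebra :=
  NonUnitalStarAlgHom.codRestrict (inflate i D.isometry_left σ) D.algebra fun a =>
    ⟨⟨a, adjoint_inflate _ _ _⟩, ⟨0, by ext; simp [inflate_apply, D.left_right]⟩,
      ⟨0, by ext; simp [inflate_apply, D.right_left]⟩,
      ⟨0, by ext; simp [inflate_apply, D.right_left]⟩⟩

/-- The inclusion of the right algebra into the linking algebra. -/
def rightHom : B →⋆ₙₐ[ℂ] D.algebra :=
  NonUnitalStarAlgHom.codRestrict (inflate j D.isometry_right ρ) D.algebra fun b =>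
    ⟨⟨0, by ext; simp [inflate_apply, D.left_right]⟩, ⟨0, by ext; simp [inflate_apply, D.left_right]⟩,
      ⟨0, by ext; simp [inflate_apply, D.right_left]⟩, ⟨b, adjoint_inflate _ _ _⟩⟩

/-- The inclusion of the bimodule into the linking algebra. -/
def creation (x : X) : D.algebra :=
  ⟨i ∘L T x ∘L j.adjoint, ⟨0, by ext; simp [D.right_left]⟩,
    ⟨x, by ext; simp [D.right_right, D.left_left]⟩, ⟨0, by ext; simp [D.right_left]⟩,
    ⟨0, by ext; simp [D.right_left]⟩⟩

lemma coe_leftHom (a : A) : (D.leftHom a : E →L[ℂ] E) = i ∘L σ a ∘L i.adjoint := rfl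

lemma coe_rightHom (b : B) : (D.rightHom b : E →L[ℂ] E) = j ∘L ρ b ∘L j.adjoint := rfl

lemma coe_creation (x : X) : (D.creation x : E →L[ℂ] E) = i ∘L T x ∘L j.adjoint := rfl

lemma coe_star_creation (x : X) :
    (star (D.creation x) : E →L[ℂ] E) = j ∘L (T x).adjoint ∘L i.adjoint := by
  rw [coe_creation, ContinuousLinearMap.star_eq_adjoint, ContinuousLinearMap.adjoint_comp,
    ContinuousLinearMap.adjoint_comp, ContinuousLinearMap.adjoint_adjoint,
    ContinuousLinearMap.comp_assoc]

/-- The two diagonal copies of A and B suffice: each component of an orthogonal vector is killed by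
a nondegenerate representation. -/
lemma nondegenerate : (Submodule.span ℂ
    {η : E | ∃ (S : D.algebra) (ζ : E), η = (S : E →L[ℂ] E) ζ}).topologicalClosure = ⊤ := by
  rw [Submodule.topologicalClosure_eq_top_iff, Submodule.eq_bot_iff]
  intro η hη
  have h0 : ∀ (S : D.algebra) ζ, inner ℂ ((S : E →L[ℂ] E) ζ) η = 0 := fun S ζ =>
    (Submodule.mem_orthogonal _ _).1 hη _ (Submodule.subset_span ⟨S, ζ, rfl⟩)
  have h1 : i.adjoint η = 0 := D.left_rep.eq_zero_of_forall fun c => ext_inner_left ℂ fun y => by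
    have := h0 (D.leftHom (star c)) (i y)
    rw [coe_leftHom, ContinuousLinearMap.comp_apply, ContinuousLinearMap.comp_apply, D.left_left,
      ← ContinuousLinearMap.adjoint_inner_right, inner_rep_left] at this
    rw [this, inner_zero_right]
  have h2 : j.adjoint η = 0 := D.right_rep.eq_zero_of_forall fun c => ext_inner_left ℂ fun y => by
    have := h0 (D.rightHom (star c)) (j y)
    rw [coe_rightHom, ContinuousLinearMap.comp_apply, ContinuousLinearMap.comp_apply, D.right_right,
      ← ContinuousLinearMap.adjoint_inner_right, inner_rep_left] at this
    rw [this, inner_zero_right]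
  rw [D.eq_sum η, h1, h2, map_zero, map_zero, add_zero]

/-- The linking algebra is a concrete Σ*-algebra. -/
instance sigmaStarAlgebra : SigmaStarAlgebra D.algebra where
  sigmaTendsto b c := WOTTendsto (fun n => (b n : E →L[ℂ] E)) c
  exists_rep := ⟨E, inferInstance, inferInstance, inferInstance,
    NonUnitalStarSubalgebraClass.subtype D.algebra,
    { injective := Subtype.val_injective
      nondegenerate := D.nondegenerate
      range_closed := fun b S h => ⟨⟨S, D.mem_algebra_of_wotTendsto h fun n => (b n).2⟩, rfl⟩
      conv_iff := fun _ _ => Iff.rfl }⟩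

lemma sigmaTendsto_leftHom_iff (b : ℕ → A) (a : A) :
    sigmaTendsto (fun n => D.leftHom (b n)) (D.leftHom a) ↔ sigmaTendsto b a :=
  (wotTendsto_inflate_iff D.isometry_left σ).trans (D.left_rep.conv_iff _ _).symm

lemma sigmaTendsto_rightHom_iff (b : ℕ → B) (a : B) :
    sigmaTendsto (fun n => D.rightHom (b n)) (D.rightHom a) ↔ sigmaTendsto b a :=
  (wotTendsto_inflate_iff D.isometry_right ρ).trans (D.right_rep.conv_iff _ _).symm

lemma leftHom_injective : Function.Injective D.leftHom := fun _ _ h =>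
  inflate_injective D.isometry_left D.left_rep.injective (congrArg Subtype.val h)

lemma rightHom_injective : Function.Injective D.rightHom := fun _ _ h =>
  inflate_injective D.isometry_right D.right_rep.injective (congrArg Subtype.val h)

lemma proj_mul_mem {S : E →L[ℂ] E} (hS : S ∈ D.algebra) : (i ∘L i.adjoint) * S ∈ D.algebra := by
  obtain ⟨⟨a, ha⟩, ⟨x, hx⟩, -, -⟩ := hS
  refine ⟨⟨a, ?_⟩, ⟨x, ?_⟩, ⟨0, ?_⟩, ⟨0, ?_⟩⟩
  · rw [← ha]; ext; simp [D.left_left]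
  · rw [← hx]; ext; simp [D.left_left]
  · ext; simp [D.right_left]
  · ext; simp [D.right_left]

lemma mul_proj_mem {S : E →L[ℂ] E} (hS : S ∈ D.algebra) : S * (i ∘L i.adjoint) ∈ D.algebra := by
  obtain ⟨⟨a, ha⟩, -, ⟨y, hy⟩, -⟩ := hS
  refine ⟨⟨a, ?_⟩, ⟨0, ?_⟩, ⟨y, ?_⟩, ⟨0, ?_⟩⟩
  · rw [← ha]; ext; simp [D.left_left]
  · ext; simp [D.left_right]
  · rw [← hy]; ext; simp [D.left_left]
  · ext; simp [D.left_right]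

/-- The projection onto the first summand, as a multiplier of the linking algebra. -/
def proj : 𝓜(ℂ, D.algebra) where
  fst := LinearMap.mkContinuous
    { toFun := fun S => ⟨(i ∘L i.adjoint) * (S : E →L[ℂ] E), D.proj_mul_mem S.2⟩
      map_add' := fun _ _ => Subtype.ext (mul_add _ _ _)
      map_smul' := fun _ _ => Subtype.ext (mul_smul_comm _ _ _) } ‖i ∘L i.adjoint‖
    fun S => norm_mul_le (i ∘L i.adjoint) (S : E →L[ℂ] E)
  snd := LinearMap.mkContinuous
    { toFun := fun S => ⟨(S : E →L[ℂ] E) * (i ∘L i.adjoint), D.mul_proj_mem S.2⟩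
      map_add' := fun _ _ => Subtype.ext (add_mul _ _ _)
      map_smul' := fun _ _ => Subtype.ext (smul_mul_assoc _ _ _) } ‖i ∘L i.adjoint‖
    fun S => (norm_mul_le (S : E →L[ℂ] E) (i ∘L i.adjoint)).trans_eq (mul_comm _ _)
  central _ _ := Subtype.ext (mul_assoc _ _ _)

lemma coe_proj_fst (S : D.algebra) :
    (D.proj.fst S : E →L[ℂ] E) = (i ∘L i.adjoint) * (S : E →L[ℂ] E) := rfl

lemma coe_proj_snd (S : D.algebra) :
    (D.proj.snd S : E →L[ℂ] E) = (S : E →L[ℂ] E) * (i ∘L i.adjoint) := rfl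

include D in
lemma compl_eq : 1 - i ∘L i.adjoint = j ∘L j.adjoint := by
  rw [sub_eq_iff_eq_add', D.add_eq_id]
  rfl

lemma coe_compl_fst (S : D.algebra) :
    ((1 - D.proj).fst S : E →L[ℂ] E) = (j ∘L j.adjoint) * (S : E →L[ℂ] E) := by
  rw [← D.compl_eq, sub_mul, one_mul]
  rfl

lemma coe_compl_snd (S : D.algebra) :
    ((1 - D.proj).snd S : E →L[ℂ] E) = (S : E →L[ℂ] E) * (j ∘L j.adjoint) := by
  rw [← D.compl_eq, mul_sub, mul_one]
  rfl

lemma isStarProjection_proj : IsStarProjection D.proj := by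
  have hidem : (i ∘L i.adjoint) * (i ∘L i.adjoint) = i ∘L i.adjoint := by
    ext; simp [D.left_left]
  have hsa : star (i ∘L i.adjoint) = i ∘L i.adjoint := by
    rw [ContinuousLinearMap.star_eq_adjoint, ContinuousLinearMap.adjoint_comp,
      ContinuousLinearMap.adjoint_adjoint]
  refine ⟨?_, ?_⟩
  · refine DoubleCentralizer.ext ℂ D.algebra _ _ (Prod.ext ?_ ?_) <;> ext1 S <;>
      refine Subtype.ext ?_
    · change (i ∘L i.adjoint) * ((i ∘L i.adjoint) * (S : E →L[ℂ] E)) = _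
      rw [← mul_assoc, hidem]
      rfl
    · change ((S : E →L[ℂ] E) * (i ∘L i.adjoint)) * (i ∘L i.adjoint) = _
      rw [mul_assoc, hidem]
      rfl
  · refine DoubleCentralizer.ext ℂ D.algebra _ _ (Prod.ext ?_ ?_) <;> ext1 S <;>
      refine Subtype.ext ?_
    · change star (star (S : E →L[ℂ] E) * (i ∘L i.adjoint)) = _
      rw [star_mul, star_star, hsa]
      rfl
    · change star ((i ∘L i.adjoint) * star (S : E →L[ℂ] E)) = _
      rw [star_mul, star_star, hsa]
      rfl

lemma exists_leftHom_eq (S : D.algebra) : ∃ a, D.leftHom a = D.proj.fst (D.proj.snd S) := by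
  obtain ⟨a, ha⟩ := S.2.1
  refine ⟨a, Subtype.ext ?_⟩
  rw [coe_leftHom, ← ha, coe_proj_fst, coe_proj_snd]
  rfl

lemma exists_rightHom_eq (S : D.algebra) :
    ∃ b, D.rightHom b = (1 - D.proj).fst ((1 - D.proj).snd S) := by
  obtain ⟨b, hb⟩ := S.2.2.2.2
  refine ⟨b, Subtype.ext ?_⟩
  rw [coe_rightHom, ← hb, coe_compl_fst, coe_compl_snd]
  rfl

/-- T_x* T_y factors through the projection p onto H, so the copy of ⟨x|y⟩ in the lower corner lies
in CpC, and right fullness makes CpC σ-dense. Symmetrically, T_x T_y* factors through 1 − p, and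
left fullness applies. -/
lemma complementarySigmaFull : ComplementarySigmaFull D.proj := by
  constructor
  · refine isSigmaDense_cornerIdeal D.isStarProjection_proj
      (fun b a h => (D.sigmaTendsto_rightHom_iff b a).2 h) D.bimodule.right_isSigmaFull ?_
      D.exists_rightHom_eq
    rintro _ ⟨x, y, rfl⟩
    refine Submodule.subset_span ⟨star (D.creation x), D.creation y, Subtype.ext ?_⟩
    rw [coe_rightHom, ← D.adjoint_comp]
    change _ = (star (D.creation x) : E →L[ℂ] E) * ((i ∘L i.adjoint) * (D.creation y : E →L[ℂ] E))
    rw [coe_star_creation, coe_creation]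
    ext ξ
    simp [D.left_left]
  · refine isSigmaDense_cornerIdeal D.isStarProjection_proj.one_sub
      (fun b a h => (D.sigmaTendsto_leftHom_iff b a).2 h) D.bimodule.left_isSigmaFull ?_ ?_
    · rintro _ ⟨x, y, rfl⟩
      refine Submodule.subset_span ⟨D.creation x, star (D.creation y), Subtype.ext ?_⟩
      rw [coe_leftHom, ← D.comp_adjoint]
      change _ = (D.creation x : E →L[ℂ] E) * ((1 - D.proj).fst (star (D.creation y)) : D.algebra)
      rw [coe_compl_fst]
      change _ = (D.creation x : E →L[ℂ] E) * ((j ∘L j.adjoint) * (star (D.creation y) : E →L[ℂ] E))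
      rw [coe_star_creation, coe_creation]
      ext ξ
      simp [D.right_right]
    · rw [sub_sub_cancel]
      exact D.exists_leftHom_eq

lemma sigmaIsomorphic_left : SigmaIsomorphic A (corner D.proj D.isStarProjection_proj) := by
  refine sigmaIsomorphic_corner _ D.leftHom_injective D.sigmaTendsto_leftHom_iff
    (fun a => ⟨Subtype.ext ?_, Subtype.ext ?_⟩) D.exists_leftHom_eq
  · rw [coe_proj_fst, coe_leftHom]; ext ξ; simp [D.left_left]
  · rw [coe_proj_snd, coe_leftHom]; ext ξ; simp [D.left_left]

lemma sigmaIsomorphic_right :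
    SigmaIsomorphic B (corner (1 - D.proj) D.isStarProjection_proj.one_sub) := by
  refine sigmaIsomorphic_corner _ D.rightHom_injective D.sigmaTendsto_rightHom_iff
    (fun a => ⟨Subtype.ext ?_, Subtype.ext ?_⟩) D.exists_rightHom_eq
  · rw [coe_compl_fst, coe_rightHom]; ext ξ; simp [D.right_right]
  · rw [coe_compl_snd, coe_rightHom]; ext ξ; simp [D.right_right]

end IsLinkingRep

end SigmaStar

end

/-! ### Assembly of the two statements -/

theorem mainTheorem4 :
    (∀ (A B : Type u) [NonUnitalCStarAlgebra A] [SigmaStar.SigmaStarAlgebra A]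
        [NonUnitalCStarAlgebra B] [SigmaStar.SigmaStarAlgebra B],
      SigmaStar.StronglyMoritaEquivalent A B ↔
        ∃ (C : Type u) (_ : NonUnitalCStarAlgebra C) (_ : SigmaStar.SigmaStarAlgebra C)
          (p : 𝓜(ℂ, C)) (hp : IsStarProjection p),
          SigmaStar.ComplementarySigmaFull p ∧
          SigmaStar.SigmaIsomorphic A (SigmaStar.corner p hp) ∧
          SigmaStar.SigmaIsomorphic B (SigmaStar.corner (1 - p) hp.one_sub)) ∧
    (∀ (C : Type u) [NonUnitalCStarAlgebra C] [SigmaStar.SigmaStarAlgebra C]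
        (p : 𝓜(ℂ, C)) (hp : IsStarProjection p),
      SigmaStar.ComplementarySigmaFull p →
        SigmaStar.IsImprimitivityBimodule (SigmaStar.leftCornerModule hp hp.one_sub)
          (SigmaStar.rightCornerModule hp hp.one_sub)) := by
  refine ⟨fun A B _ _ _ _ => ⟨?_, ?_⟩, fun C _ _ p hp h =>
    SigmaStar.isImprimitivityBimodule_corner hp hp.one_sub h.1 h.2⟩
  · rintro ⟨X, _, _, L, R, h⟩
    obtain ⟨H, V, E, _, _, _, _, _, _, _, _, _, σ, ρ, T, i, j, D⟩ := h.exists_isLinkingRep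
    exact ⟨D.algebra, inferInstance, D.sigmaStarAlgebra, D.proj, D.isStarProjection_proj,
      D.complementarySigmaFull, D.sigmaIsomorphic_left, D.sigmaIsomorphic_right⟩
  · rintro ⟨C, _, _, p, hp, h, ⟨φ, hφ, hφ'⟩, ψ, hψ, hψ'⟩
    exact ⟨_, _, _, _, _,
      (SigmaStar.isImprimitivityBimodule_corner hp hp.one_sub h.1 h.2).transport hφ hφ' hψ hψ'⟩
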